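/- Let $C$ be a field of characteristic zero, $\bar C\supseteq C$ an algebraically closed field, and $\alpha\in\bar C$. For a field $k$ with $C\subseteq k\subseteq\bar C$ put $k[[[x-\alpha]]]=\bigcup_{\nu\in C}(x-\alpha)^\nu k[[x-\alpha]][\log(x-\alpha)]$. Operators in $C(x)[D]$ (where $Da=aD+a'$ for $a\in C(x)$) act on finite sums of such series, rational functions being expanded at $\alpha$ and $D$ acting as $d/dx$. Fix a function $\iota\colon C/\mathbb Z\times\mathbb N\to C$ such that, for all $\nu,\nu_1,\nu_2\in C$ and $j,j_1,j_2\in\mathbb N$: $\iota(\nu+\mathbb Z,j)\in\nu+\mathbb Z$; $\iota(\nu_1+\mathbb Z,j_1)+\iota(\nu_2+\mathbb Z,j_2)-\iota(\nu_1+\nu_2+\mathbb Z,j_1+j_2)$ is a nonnegative integer; and $\iota(\mathbb Z,0)=0$. A finite sum of elements of $\bar C[[[x-\alpha]]]$ is called integral if for every term $(x-\alpha)^\mu\log(x-\alpha)^j$ occurring in it with nonzero coefficient, $\mu-\iota(\mu+\mathbb Z,j)$ is a nonnegative integer. Let $L\in C(x)[D]$ be a nonzero operator of order $r$ that has a fundamental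 system $b_1,\dots,b_r\in C(\alpha)[[[x-\alpha]]]$, i.e. $r$ solutions of $L$ that are linearly independent over $\bar C$. Write $$b_i=\sum_{k=0}^\infty b_{i,k}(\log(x-\alpha))\,(x-\alpha)^{\nu_i+k},\qquad \nu_i\in C,\quad b_{i,0}\ne0,$$ with polynomials $b_{i,k}$ of degree at most $d_i\in\mathbb N$ for all $k$. Let $m\in\mathbb N$ be the number for which the Wronskian of the $b_i$ has the form $$\det(D^j\cdot b_i)_{1\le i\le r,\,0\le j<r}=\sum_{k=0}^\infty w_k\,(x-\alpha)^{\nu_1+\cdots+\nu_r-r(r-1)/2+m+k},\qquad w_0\neq0 .$$ Let $N_1,\dots,N_r\in\mathbb N$ be given by $$N_i=m+\max_{1\le j\le r,\ 0\le k<d_i+r}\bigl(\iota(\nu_i-\nu_j+\mathbb Z,k)-(\nu_i-\nu_j)\bigr)$$ (a maximum of integers), and let $$t_i=\sum_{k=0}^{N_i}b_{i,k}(\log(x-\alpha))\,(x-\alpha)^{\nu_i+k}\qquad(1\le i\le r).$$ Let $\langle L\rangle=C(x)[D]L$ be the left ideal generated by $L$, and let a class $B\in C(x)[D]/\langle L\rangle$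 act on series through its unique representative $c_0+c_1D+\cdots+c_{r-1}D^{r-1}$ with $c_i\in C(x)$. Then for every $B\in C(x)[D]/\langle L\rangle$: all of $B\cdot b_1,\dots,B\cdot b_r$ are integral if and only if all of $B\cdot t_1,\dots,B\cdot t_r$ are integral. -/

import Mathlib

noncomputable section

open Polynomial

/-! ## Series in `(x - α)` and `log (x - α)` with exponents in `C` -/

/-- The field `C` of exponents, partially ordered by `μ ≤ ν ↔ ν - μ ∈ ℕ`. -/
def Expo (C : Type*) : Type _ := C

namespace Expo

instance {C : Type*} [Field C] : AddCommGroup (Expo C) := inferInstanceAs (AddCommGroup C)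

/-- An element of `C`, seen as an exponent. -/
def of {C : Type*} [Field C] : C ≃+ Expo C := AddEquiv.refl C

/-- An exponent, seen as an element of `C`. -/
def val {C : Type*} [Field C] : Expo C ≃+ C := AddEquiv.refl C

instance {C : Type*} [Field C] [CharZero C] : PartialOrder (Expo C) where
  le μ ν := ∃ n : ℕ, val ν = val μ + n
  le_refl μ := ⟨0, by simp⟩
  le_trans μ ν κ := by
    rintro ⟨m, hm⟩ ⟨n, hn⟩
    exact ⟨m + n, by rw [hn, hm]; push_cast; ring⟩
  le_antisymm μ ν := by
    rintro ⟨m, hm⟩ ⟨n, hn⟩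
    have h : ((m + n : ℕ) : C) = 0 := by
      rw [hm] at hn
      push_cast
      linear_combination -hn
    have h2 : m + n = 0 := by exact_mod_cast h
    have h3 : m = 0 := by omega
    subst h3
    apply val.injective
    rw [hm]; simp

theorem le_iff {C : Type*} [Field C] [CharZero C] {μ ν : Expo C} :
    μ ≤ ν ↔ ∃ n : ℕ, val ν = val μ + n := Iff.rfl

instance {C : Type*} [Field C] [CharZero C] : IsOrderedCancelAddMonoid (Expo C) where
  add_le_add_left μ ν h κ := by
    obtain ⟨n, hn⟩ := h
    exact ⟨n, by rw [map_add, map_add, hn]; ring⟩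
  le_of_add_le_add_left μ ν κ h := by
    obtain ⟨n, hn⟩ := h
    refine ⟨n, ?_⟩
    rw [map_add, map_add] at hn
    linear_combination hn

end Expo

/-- Log-free generalized series `∑ a_μ (x - α)^μ` with coefficients in `K`.  A set of exponents is
partially well-ordered for the order of `Expo C` exactly if it lies in a finite union of sets
`ν + ℕ`, so these are the finite sums of elements of `⋃_ν (x - α)^ν K[[x - α]]`. -/
abbrev PowSeries (C K : Type*) [Field C] [CharZero C] [Field K] : Type _ :=
  HahnSeries (Expo C) K

/-- The ring of finite sums of elements of `⋃_ν (x - α)^ν K[[x - α]][log (x - α)]`; the polynomial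
variable is `log (x - α)`. -/
abbrev GenSeries (C K : Type*) [Field C] [CharZero C] [Field K] : Type _ :=
  (PowSeries C K)[X]

/-- The term `(x - α)^μ`. -/
def powTerm (C K : Type*) [Field C] [CharZero C] [Field K] (μ : C) : PowSeries C K :=
  HahnSeries.single (Expo.of μ) 1

/-- The polynomial `p` in the expansion `∑_μ p_μ(log (x - α)) (x - α)^μ` of `f`, for given `μ`. -/
def expCoeff {C K : Type*} [Field C] [CharZero C] [Field K] (f : GenSeries C K) (μ : C) : K[X] :=
  f.sum fun j h => monomial j (h.coeff (Expo.of μ))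

theorem expCoeff_coeff {C K : Type*} [Field C] [CharZero C] [Field K] (f : GenSeries C K) (μ : C)
    (j : ℕ) : (expCoeff f μ).coeff j = (f.coeff j).coeff (Expo.of μ) := by
  classical
  unfold expCoeff
  rw [Polynomial.sum_def, Polynomial.finsetSum_coeff]
  simp only [coeff_monomial]
  rw [Finset.sum_ite_eq']
  split_ifs with h
  · rfl
  · rw [notMem_support_iff.mp h]; simp

/-! ## Differentiation of series -/

/-- The coefficientwise extension of a derivation to polynomials, sending the variable to `0`. -/
def coeffwise {R A : Type*} [CommRing R] [CommRing A] [Algebra R A] (δ : Derivation R A A) :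
    Derivation R A[X] A[X] :=
  (PolynomialModule.equivPolynomialSelf (R := A)).toLinearMap.compDer δ.mapCoeffs

theorem coeffwise_coeff {R A : Type*} [CommRing R] [CommRing A] [Algebra R A]
    (δ : Derivation R A A) (f : A[X]) (n : ℕ) : (coeffwise δ f).coeff n = δ (f.coeff n) := rfl

/-- The extension of a derivation of `A` to `A[X]` that sends the variable to `u`. -/
def extendDer {R A : Type*} [CommRing R] [CommRing A] [Algebra R A] (δ : Derivation R A A) (u : A) :
    Derivation R A[X] A[X] :=
  coeffwise δ + (Polynomial.C u : A[X]) • (derivative' (R := A)).restrictScalars R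

/-- The map `(x - α) d/dx` on log-free series, sending `(x - α)^μ` to `μ (x - α)^μ`. -/
def eulerFun {C K : Type*} [Field C] [CharZero C] [Field K] [Algebra C K] (f : PowSeries C K) :
    PowSeries C K where
  coeff := fun μ => algebraMap C K (Expo.val μ) * f.coeff μ
  isPWO_support' := f.isPWO_support.mono fun μ hμ => by
    intro h0
    apply hμ
    simp [h0]

theorem eulerFun_support {C K : Type*} [Field C] [CharZero C] [Field K] [Algebra C K]
    (f : PowSeries C K) : (eulerFun f).support ⊆ f.support :=
  fun μ hμ h0 => hμ (by simp [eulerFun, h0])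

theorem eulerFun_mul {C K : Type*} [Field C] [CharZero C] [Field K] [Algebra C K]
    (f g : PowSeries C K) : eulerFun (f * g) = f * eulerFun g + eulerFun f * g := by
  ext μ
  rw [HahnSeries.coeff_add, HahnSeries.coeff_mul_right' g.isPWO_support (eulerFun_support g),
    HahnSeries.coeff_mul_left' f.isPWO_support (eulerFun_support f)]
  change algebraMap C K (Expo.val μ) * (f * g).coeff μ = _
  rw [HahnSeries.coeff_mul, Finset.mul_sum, ← Finset.sum_add_distrib]
  refine Finset.sum_congr rfl fun ij hij => ?_
  rw [Finset.mem_antidiagonal] at hij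
  rw [← hij.2.2, map_add, map_add]
  simp only [eulerFun]
  ring

/-- The Euler derivation `(x - α) d/dx`. -/
def eulerDer (C K : Type*) [Field C] [CharZero C] [Field K] [Algebra C K] :
    Derivation K (PowSeries C K) (PowSeries C K) :=
  Derivation.mk'
    { toFun := eulerFun
      map_add' := fun f g => by ext μ; simp [eulerFun, mul_add]
      map_smul' := fun c f => by ext μ; simp [eulerFun]; ring }
    (fun f g => by
      change eulerFun (f * g) = f * eulerFun g + g * eulerFun f
      rw [eulerFun_mul, mul_comm g])

/-- The derivation `d/dx` on log-free series: `(x - α)^μ ↦ μ (x - α)^(μ - 1)`. -/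
def powDer (C K : Type*) [Field C] [CharZero C] [Field K] [Algebra C K] :
    Derivation K (PowSeries C K) (PowSeries C K) :=
  powTerm C K (-1) • eulerDer C K

/-- The derivation `D = d/dx` on generalized series: it acts on log-free series as above, and sends
`log (x - α)` to `(x - α)^(-1)`. -/
def serDer (C K : Type*) [Field C] [CharZero C] [Field K] [Algebra C K] :
    Derivation K (GenSeries C K) (GenSeries C K) :=
  extendDer (powDer C K) (powTerm C K (-1))

/-! ## Expansion of rational functions at `α` -/

/-- Laurent series in `x - α` as generalized series. -/
def laurentToPow (C K : Type*) [Field C] [CharZero C] [Field K] :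
    LaurentSeries K →+* PowSeries C K :=
  HahnSeries.embDomainRingHom
    ((Expo.of (C := C)).toAddMonoidHom.comp (Int.castAddHom C))
    (fun a b h => by
      have h' : ((a : ℤ) : C) = (b : C) := h
      exact_mod_cast h')
    (fun a b => by
      change (∃ n : ℕ, ((b : ℤ) : C) = (a : C) + n) ↔ _
      constructor
      · rintro ⟨n, hn⟩
        have h : b = a + n := by exact_mod_cast hn
        omega
      · intro h
        obtain ⟨n, rfl⟩ := Int.le.dest h
        exact ⟨n, by push_cast; rfl⟩)

/-- The expansion of a polynomial at `α`, as a Laurent series. -/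
def expandPoly (C : Type*) {K : Type*} [Field C] [Field K] [Algebra C K] (α : K) :
    C[X] →+* LaurentSeries K :=
  (HahnSeries.ofPowerSeries ℤ K).comp
    ((coeToPowerSeries.ringHom (R := K)).comp
      ((taylorAlgHom α).toRingHom.comp (mapRingHom (algebraMap C K))))

theorem expandPoly_injective (C : Type*) {K : Type*} [Field C] [Field K] [Algebra C K] (α : K) :
    Function.Injective (expandPoly C α) := by
  refine HahnSeries.ofPowerSeries_injective.comp ?_
  refine (Polynomial.coe_injective K).comp ?_
  exact (taylor_injective α).comp (map_injective _ (algebraMap C K).injective)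

/-- The expansion of a rational function at `α`, as a generalized series without logarithms. -/
def expandRat {C K : Type*} [Field C] [CharZero C] [Field K] [Algebra C K] (α : K) :
    RatFunc C →+* PowSeries C K :=
  (laurentToPow C K).comp
    (IsFractionRing.lift (A := C[X]) (K := RatFunc C) (expandPoly_injective C α))

/-! ## Differential operators over a differential ring -/

theorem end_mul_apply {M : Type*} [AddCommMonoid M] (f g : AddMonoid.End M) (x : M) :
    (f * g) x = f (g x) := rfl

theorem end_one_apply {M : Type*} [AddCommMonoid M] (x : M) : (1 : AddMonoid.End M) x = x := rfl

/-- Left multiplication by `D` on operators `∑ a_i D^i` (encoded as polynomials with the same left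
coefficients): `D (a D^i) = a D^(i+1) + a' D^i`. -/
def mulD {R F : Type*} [CommRing R] [CommRing F] [Algebra R F] (δ : Derivation R F F) :
    AddMonoid.End F[X] :=
  AddMonoidHom.mulRight X + (coeffwise δ).toLinearMap.toAddMonoidHom

theorem mulD_apply {R F : Type*} [CommRing R] [CommRing F] [Algebra R F] (δ : Derivation R F F)
    (Q : F[X]) : mulD δ Q = Q * X + coeffwise δ Q := rfl

theorem mulD_smul {R F : Type*} [CommRing R] [CommRing F] [Algebra R F] (δ : Derivation R F F)
    (a : F) (Q : F[X]) : mulD δ (a • Q) = a • mulD δ Q + δ a • Q := by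
  have h : coeffwise δ (a • Q) = a • coeffwise δ Q + δ a • Q := by
    ext n
    simp [coeffwise_coeff, mul_comm]
  rw [mulD_apply, mulD_apply, h, smul_add, smul_mul_assoc, add_assoc]

theorem mulD_monomial {R F : Type*} [CommRing R] [CommRing F] [Algebra R F] (δ : Derivation R F F)
    (n : ℕ) (a : F) : mulD δ (monomial n a) = monomial (n + 1) a + monomial n (δ a) := by
  rw [mulD_apply, monomial_mul_X]
  congr 1
  ext k
  rw [coeffwise_coeff, coeff_monomial, coeff_monomial]
  split_ifs <;> simp

/-- Left multiplication by the operator `∑ a_i D^i`. -/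
def mulLeft {R F : Type*} [CommRing R] [CommRing F] [Algebra R F] (δ : Derivation R F F) :
    F[X] →+ AddMonoid.End F[X] :=
  eval₂AddMonoidHom (Module.toAddMonoidEnd F F[X]) (mulD δ)

theorem mulLeft_add {R F : Type*} [CommRing R] [CommRing F] [Algebra R F] (δ : Derivation R F F)
    (P P' Q : F[X]) : mulLeft δ (P + P') Q = mulLeft δ P Q + mulLeft δ P' Q := by
  rw [map_add]
  rfl

theorem mulLeft_monomial {R F : Type*} [CommRing R] [CommRing F] [Algebra R F]
    (δ : Derivation R F F) (n : ℕ) (a : F) (Q : F[X]) :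
    mulLeft δ (monomial n a) Q = a • (mulD δ ^ n) Q := by
  rw [mulLeft, eval₂AddMonoidHom_apply, eval₂_monomial, end_mul_apply]
  rfl

theorem mulLeft_smul {R F : Type*} [CommRing R] [CommRing F] [Algebra R F] (δ : Derivation R F F)
    (a : F) (P Q : F[X]) : mulLeft δ (a • P) Q = a • mulLeft δ P Q := by
  induction P using Polynomial.induction_on' with
  | add S S' hS hS' => rw [smul_add, mulLeft_add, mulLeft_add, hS, hS', smul_add]
  | monomial k c => rw [smul_monomial, mulLeft_monomial, mulLeft_monomial, smul_eq_mul, mul_smul]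

theorem mulLeft_mulD {R F : Type*} [CommRing R] [CommRing F] [Algebra R F] (δ : Derivation R F F)
    (P Q : F[X]) : mulLeft δ (mulD δ P) Q = mulD δ (mulLeft δ P Q) := by
  induction P using Polynomial.induction_on' with
  | add P P' hP hP' => rw [map_add, mulLeft_add, mulLeft_add, hP, hP', map_add]
  | monomial n a =>
    rw [mulD_monomial, mulLeft_add, mulLeft_monomial, mulLeft_monomial, mulLeft_monomial,
      mulD_smul, pow_succ', end_mul_apply]

theorem mulLeft_mulD_pow {R F : Type*} [CommRing R] [CommRing F] [Algebra R F]
    (δ : Derivation R F F) (n : ℕ) (P Q : F[X]) :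
    mulLeft δ ((mulD δ ^ n) P) Q = (mulD δ ^ n) (mulLeft δ P Q) := by
  induction n with
  | zero => rfl
  | succ n ih => rw [pow_succ', end_mul_apply, end_mul_apply, mulLeft_mulD, ih]

theorem mulLeft_mulLeft {R F : Type*} [CommRing R] [CommRing F] [Algebra R F]
    (δ : Derivation R F F) (P Q S : F[X]) :
    mulLeft δ (mulLeft δ P Q) S = mulLeft δ P (mulLeft δ Q S) := by
  induction P using Polynomial.induction_on' with
  | add P P' hP hP' => rw [mulLeft_add, mulLeft_add, mulLeft_add, hP, hP']
  | monomial n a => rw [mulLeft_monomial, mulLeft_monomial, mulLeft_smul, mulLeft_mulD_pow]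

theorem mulD_pow_one {R F : Type*} [CommRing R] [CommRing F] [Algebra R F]
    (δ : Derivation R F F) (n : ℕ) : (mulD δ ^ n) (1 : F[X]) = monomial n 1 := by
  induction n with
  | zero => rfl
  | succ n ih =>
    rw [pow_succ', end_mul_apply, ih, mulD_monomial, Derivation.map_one_eq_zero,
      monomial_zero_right, add_zero]

theorem mulLeft_apply_one {R F : Type*} [CommRing R] [CommRing F] [Algebra R F]
    (δ : Derivation R F F) (P : F[X]) : mulLeft δ P 1 = P := by
  induction P using Polynomial.induction_on' with
  | add P Q hP hQ => rw [mulLeft_add, hP, hQ]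
  | monomial n a => rw [mulLeft_monomial, mulD_pow_one, smul_monomial, smul_eq_mul, mul_one]

theorem mulLeft_one {R F : Type*} [CommRing R] [CommRing F] [Algebra R F]
    (δ : Derivation R F F) (P : F[X]) : mulLeft δ 1 P = P := by
  rw [← monomial_zero_one (R := F), mulLeft_monomial, one_smul, pow_zero, end_one_apply]

/-! ## The ring `C(x)[D]` of differential operators -/

/-- The numerator of the quotient rule. -/
def quotRule {C : Type*} [Field C] (p q : C[X]) : C[X] :=
  derivative p * q - p * derivative q

theorem quotRule_eq {C : Type*} [Field C] {p q p' q' : C[X]} (hq : q ≠ 0) (hq' : q' ≠ 0)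
    (h : p * q' = p' * q) :
    algebraMap C[X] (RatFunc C) (quotRule p q) / algebraMap C[X] (RatFunc C) q ^ 2 =
      algebraMap C[X] (RatFunc C) (quotRule p' q') / algebraMap C[X] (RatFunc C) q' ^ 2 := by
  have h1 : algebraMap C[X] (RatFunc C) q ≠ 0 := RatFunc.algebraMap_ne_zero hq
  have h2 : algebraMap C[X] (RatFunc C) q' ≠ 0 := RatFunc.algebraMap_ne_zero hq'
  rw [div_eq_div_iff (pow_ne_zero 2 h1) (pow_ne_zero 2 h2)]
  simp only [← map_pow, ← map_mul]
  congr 1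
  have hd := congrArg derivative h
  simp only [derivative_mul] at hd
  unfold quotRule
  linear_combination (q * q') * hd - (derivative q * q' + q * derivative q') * h

/-- The derivative of a rational function, by the quotient rule. -/
def ratDerFun {C : Type*} [Field C] (f : RatFunc C) : RatFunc C :=
  algebraMap C[X] (RatFunc C) (quotRule f.num f.denom) / algebraMap C[X] (RatFunc C) f.denom ^ 2

theorem ratDerFun_div {C : Type*} [Field C] (p : C[X]) {q : C[X]} (hq : q ≠ 0) :
    ratDerFun (algebraMap C[X] (RatFunc C) p / algebraMap C[X] (RatFunc C) q) =
      algebraMap C[X] (RatFunc C) (quotRule p q) / algebraMap C[X] (RatFunc C) q ^ 2 :=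
  quotRule_eq (RatFunc.denom_ne_zero _) hq (RatFunc.num_mul_eq_mul_denom_iff hq |>.mpr rfl)

/-- The derivation `d/dx` on `C(x)`. -/
def ratDer (C : Type*) [Field C] : Derivation C (RatFunc C) (RatFunc C) :=
  Derivation.mk'
    { toFun := ratDerFun
      map_add' := fun f g => by
        induction f using RatFunc.induction_on with | _ p q hq
        induction g using RatFunc.induction_on with | _ p' q' hq'
        have h1 : algebraMap C[X] (RatFunc C) q ≠ 0 := RatFunc.algebraMap_ne_zero hq
        have h2 : algebraMap C[X] (RatFunc C) q' ≠ 0 := RatFunc.algebraMap_ne_zero hq'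
        rw [div_add_div _ _ h1 h2]
        simp only [← map_mul, ← map_add]
        rw [ratDerFun_div _ (mul_ne_zero hq hq'), ratDerFun_div _ hq, ratDerFun_div _ hq']
        simp only [quotRule, derivative_mul, map_add, map_sub, map_mul]
        field_simp
        ring
      map_smul' := fun c f => by
        induction f using RatFunc.induction_on with | _ p q hq
        have h1 : algebraMap C[X] (RatFunc C) q ≠ 0 := RatFunc.algebraMap_ne_zero hq
        have h2 : quotRule (c • p) q = c • quotRule p q := by
          rw [quotRule, quotRule, derivative_smul, smul_mul_assoc, smul_mul_assoc, smul_sub]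
        rw [← RatFunc.div_smul, ratDerFun_div _ hq, ratDerFun_div _ hq, RingHom.id_apply, h2,
          ← map_pow, RatFunc.div_smul] }
    (fun f g => by
        induction f using RatFunc.induction_on with | _ p q hq
        induction g using RatFunc.induction_on with | _ p' q' hq'
        have h1 : algebraMap C[X] (RatFunc C) q ≠ 0 := RatFunc.algebraMap_ne_zero hq
        have h2 : algebraMap C[X] (RatFunc C) q' ≠ 0 := RatFunc.algebraMap_ne_zero hq'
        change ratDerFun _ = _ • ratDerFun _ + _ • ratDerFun _
        rw [div_mul_div_comm]
        simp only [← map_mul]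
        rw [ratDerFun_div _ (mul_ne_zero hq hq'), ratDerFun_div _ hq, ratDerFun_div _ hq']
        simp only [quotRule, derivative_mul, map_add, map_sub, map_mul, smul_eq_mul]
        field_simp
        ring)

/-- Differential operators `∑ a_i D^i` with coefficients `a_i ∈ C(x)` written on the left. -/
def DiffOp (C : Type*) [Field C] : Type _ := (RatFunc C)[X]

namespace DiffOp

instance {C : Type*} [Field C] : AddCommGroup (DiffOp C) :=
  inferInstanceAs (AddCommGroup (RatFunc C)[X])

/-- The operator as a (commutative) polynomial with the same left coefficients. -/
def toPoly {C : Type*} [Field C] : DiffOp C ≃+ (RatFunc C)[X] := AddEquiv.refl _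

/-- The coefficient of `D^i`. -/
def coeff {C : Type*} [Field C] (P : DiffOp C) (i : ℕ) : RatFunc C := P.toPoly.coeff i

/-- The order of an operator. -/
def order {C : Type*} [Field C] (P : DiffOp C) : ℕ := P.toPoly.natDegree

/-- The ring structure of `C(x)[D]`, with `D a = a D + a'` for `a ∈ C(x)`. -/
instance {C : Type*} [Field C] : Ring (DiffOp C) :=
  { (inferInstance : AddCommGroup (DiffOp C)) with
    mul := fun P Q => toPoly.symm (mulLeft (ratDer C) P.toPoly Q.toPoly)
    one := toPoly.symm 1
    left_distrib := fun P Q R => (mulLeft (ratDer C) P.toPoly).map_add Q.toPoly R.toPoly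
    right_distrib := fun P Q R => mulLeft_add (ratDer C) P.toPoly Q.toPoly R.toPoly
    zero_mul := fun P => DFunLike.congr_fun (mulLeft (ratDer C)).map_zero P.toPoly
    mul_zero := fun P => (mulLeft (ratDer C) P.toPoly).map_zero
    mul_assoc := fun P Q R => mulLeft_mulLeft (ratDer C) P.toPoly Q.toPoly R.toPoly
    one_mul := fun P => mulLeft_one (ratDer C) P.toPoly
    mul_one := fun P => mulLeft_apply_one (ratDer C) P.toPoly }

theorem toPoly_mul {C : Type*} [Field C] (P Q : DiffOp C) :
    (P * Q).toPoly = mulLeft (ratDer C) P.toPoly Q.toPoly := rfl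

end DiffOp

/-! ## Reduction modulo the left ideal generated by `L` -/

/-- The left ideal `⟨L⟩ = C(x)[D] L`. -/
def leftIdeal {C : Type*} [Field C] (L : DiffOp C) : Submodule (DiffOp C) (DiffOp C) :=
  Submodule.span (DiffOp C) {L}

/-- `R` is the representative of the class `B ∈ C(x)[D]/⟨L⟩` that is a `C(x)`-linear combination of
`1, D, …, D^(r-1)`, where `r` is the order of `L`. -/
def IsNormalForm {C : Type*} [Field C] {L : DiffOp C} (B : DiffOp C ⧸ leftIdeal L) (R : DiffOp C) :
    Prop :=
  Submodule.Quotient.mk R = B ∧ ∀ i, L.order ≤ i → R.coeff i = 0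

theorem coeff_mulD_pow {R F : Type*} [CommRing R] [CommRing F] [Algebra R F]
    (δ : Derivation R F F) {Q : F[X]} {d : ℕ} (hQ : ∀ i, d < i → Q.coeff i = 0) (j : ℕ) :
    (∀ i, d + j < i → ((mulD δ ^ j) Q).coeff i = 0) ∧
      ((mulD δ ^ j) Q).coeff (d + j) = Q.coeff d := by
  induction j with
  | zero => exact ⟨hQ, rfl⟩
  | succ j ih =>
    obtain ⟨h1, h2⟩ := ih
    have h : ∀ i, ((mulD δ ^ (j + 1)) Q).coeff (i + 1) =
        ((mulD δ ^ j) Q).coeff i + δ (((mulD δ ^ j) Q).coeff (i + 1)) := by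
      intro i
      rw [pow_succ', end_mul_apply, mulD_apply, coeff_add, coeff_mul_X, coeffwise_coeff]
    constructor
    · intro i hi
      obtain ⟨k, rfl⟩ : ∃ k, i = k + 1 := ⟨i - 1, by omega⟩
      rw [h, h1 k (by omega), h1 (k + 1) (by omega), map_zero, add_zero]
    · rw [← add_assoc, h, h1 (d + j + 1) (by omega), map_zero, add_zero, h2]

theorem coeff_mulLeft_top {R F : Type*} [CommRing R] [CommRing F] [Algebra R F]
    (δ : Derivation R F F) {Q : F[X]} {d : ℕ} (hQ : ∀ i, d < i → Q.coeff i = 0) (P : F[X]) :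
    (mulLeft δ P Q).coeff (d + P.natDegree) = P.leadingCoeff * Q.coeff d := by
  have h : ∀ i, (mulLeft δ (monomial i (P.coeff i)) Q).coeff (d + P.natDegree) =
      P.coeff i * ((mulD δ ^ i) Q).coeff (d + P.natDegree) := by
    intro i
    rw [mulLeft_monomial, coeff_smul, smul_eq_mul]
  have h2 : mulLeft δ P Q =
      ∑ i ∈ Finset.range (P.natDegree + 1), mulLeft δ (monomial i (P.coeff i)) Q := by
    have h3 : ∀ s : Finset ℕ, mulLeft δ (∑ i ∈ s, monomial i (P.coeff i)) Q =
        ∑ i ∈ s, mulLeft δ (monomial i (P.coeff i)) Q := by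
      intro s
      classical
      induction s using Finset.induction_on with
      | empty => rw [Finset.sum_empty, Finset.sum_empty, map_zero]; rfl
      | insert a s ha ih => rw [Finset.sum_insert ha, Finset.sum_insert ha, mulLeft_add, ih]
    conv_lhs => rw [P.as_sum_range]
    exact h3 _
  rw [h2, finsetSum_coeff, Finset.sum_range_succ, Finset.sum_eq_zero, zero_add, h,
    (coeff_mulD_pow δ hQ _).2]
  · rfl
  · intro i hi
    rw [Finset.mem_range] at hi
    rw [h, (coeff_mulD_pow δ hQ i).1 _ (by omega), mul_zero]

open DiffOp in
theorem existsUnique_isNormalForm {C : Type*} [Field C] {L : DiffOp C} (hL : L ≠ 0)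
    (B : DiffOp C ⧸ leftIdeal L) : ∃! R, IsNormalForm B R := by
  have hlc : L.toPoly.coeff L.order ≠ 0 := by
    intro h
    apply hL
    exact (leadingCoeff_eq_zero (p := L.toPoly)).mp h
  have hdeg : ∀ i, L.order < i → L.toPoly.coeff i = 0 := fun i hi =>
    coeff_eq_zero_of_natDegree_lt hi
  have key : ∀ n, ∀ P : DiffOp C, (∀ i, n ≤ i → P.coeff i = 0) →
      ∃ R : DiffOp C, P - R ∈ leftIdeal L ∧ ∀ i, L.order ≤ i → R.coeff i = 0 := by
    intro n
    induction n with
    | zero => exact fun P hP => ⟨P, by simp, fun i _ => hP i (Nat.zero_le i)⟩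
    | succ n ih =>
      intro P hP
      by_cases hn : n < L.order
      · exact ⟨P, by simp, fun i hi => hP i (by omega)⟩
      · set M : DiffOp C :=
          toPoly.symm (monomial (n - L.order) (P.coeff n / L.toPoly.coeff L.order)) with hM
        have hML : ∀ i, (M * L).coeff i = P.coeff n / L.toPoly.coeff L.order *
            ((mulD (ratDer C) ^ (n - L.order)) L.toPoly).coeff i := by
          intro i
          rw [DiffOp.coeff, toPoly_mul, hM, AddEquiv.apply_symm_apply, mulLeft_monomial, coeff_smul,
            smul_eq_mul]
        have hMi : M * L ∈ leftIdeal L :=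
          Submodule.smul_mem _ M (Submodule.subset_span rfl)
        obtain ⟨R, hR1, hR2⟩ := ih (P - M * L) (by
          intro i hi
          have hsub : (P - M * L).coeff i = P.coeff i - (M * L).coeff i := coeff_sub _ _ i
          rw [hsub, hML]
          obtain ⟨h1, h2⟩ := coeff_mulD_pow (ratDer C) hdeg (n - L.order)
          have hadd : L.order + (n - L.order) = n := by omega
          rw [hadd] at h1 h2
          rcases hi.eq_or_lt with rfl | hi
          · rw [h2, div_mul_cancel₀ _ hlc, sub_self]
          · rw [h1 i hi, hP i hi, mul_zero, sub_zero])
        refine ⟨R, ?_, hR2⟩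
        have := Submodule.add_mem _ hR1 hMi
        rwa [show P - M * L - R + M * L = P - R by abel] at this
  obtain ⟨P, rfl⟩ := Submodule.Quotient.mk_surjective _ B
  obtain ⟨R, hR1, hR2⟩ := key (P.order + 1) P
    (fun i hi => coeff_eq_zero_of_natDegree_lt (p := P.toPoly) hi)
  refine ⟨R, ⟨((Submodule.Quotient.eq _).mpr hR1).symm, hR2⟩, ?_⟩
  rintro S ⟨hS1, hS2⟩
  have hmem : S - R ∈ leftIdeal L := by
    have h1 := (Submodule.Quotient.eq _).mp hS1
    have := Submodule.add_mem _ h1 hR1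
    rwa [sub_add_sub_cancel] at this
  obtain ⟨Q, hQ⟩ := Submodule.mem_span_singleton.mp hmem
  have hc : (S - R).coeff (L.order + Q.order) = 0 := by
    have hsub : (S - R).coeff (L.order + Q.order) =
      S.coeff (L.order + Q.order) - R.coeff (L.order + Q.order) := coeff_sub _ _ _
    rw [hsub, hS2 _ (by omega), hR2 _ (by omega), sub_zero]
  rw [← hQ, smul_eq_mul, DiffOp.coeff, toPoly_mul] at hc
  replace hc := (coeff_mulLeft_top (ratDer C) hdeg Q.toPoly).symm.trans hc
  have hQ0 : Q = 0 := by
    rcases mul_eq_zero.mp hc with h | h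
    · exact leadingCoeff_eq_zero.mp h
    · exact absurd h hlc
  rw [hQ0, zero_smul] at hQ
  exact sub_eq_zero.mp hQ.symm

/-- The representative of `B ∈ C(x)[D]/⟨L⟩` in `C(x) + C(x) D + ⋯ + C(x) D^(r-1)`. -/
def reduced {C : Type*} [Field C] {L : DiffOp C} (B : DiffOp C ⧸ leftIdeal L) : DiffOp C :=
  Classical.epsilon (IsNormalForm B)

/-! ## Operators acting on series -/

/-- The action `P · f = ∑ a_i D^i f` of `P = ∑ a_i D^i ∈ C(x)[D]` on series in `x - α`. -/
def act {C K : Type*} [Field C] [CharZero C] [Field K] [Algebra C K] (α : K) (P : DiffOp C)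
    (f : GenSeries C K) : GenSeries C K :=
  P.toPoly.sum fun i a => Polynomial.C (expandRat α a) * (serDer C K)^[i] f

/-- The action of `B ∈ C(x)[D]/⟨L⟩` on series, as `B = c_0 + c_1 D + ⋯ + c_(r-1) D^(r-1)`. -/
def actClass {C K : Type*} [Field C] [CharZero C] [Field K] [Algebra C K] (α : K) {L : DiffOp C}
    (B : DiffOp C ⧸ leftIdeal L) (f : GenSeries C K) : GenSeries C K :=
  act α (reduced B) f

theorem reduced_spec {C : Type*} [Field C] {L : DiffOp C} (hL : L ≠ 0)
    (B : DiffOp C ⧸ leftIdeal L) : IsNormalForm B (reduced B) :=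
  Classical.epsilon_spec (existsUnique_isNormalForm hL B).exists

/-! ## Integral series -/

/-- The functions `ι : C/ℤ × ℕ → C` that may serve to define integrality. -/
structure Threshold (C : Type*) [Field C] where
  /-- The underlying function. -/
  toFun : C ⧸ AddSubgroup.zmultiples (1 : C) → ℕ → C
  mem_coset : ∀ (ν : C) (j : ℕ), ∃ n : ℤ, toFun ν j = ν + n
  superadditive : ∀ (ν₁ ν₂ : C) (j₁ j₂ : ℕ), ∃ n : ℕ,
    toFun ν₁ j₁ + toFun ν₂ j₂ - toFun ((ν₁ + ν₂ : C) : C ⧸ AddSubgroup.zmultiples (1 : C))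
      (j₁ + j₂) = n
  zero : toFun ((0 : C) : C ⧸ AddSubgroup.zmultiples (1 : C)) 0 = 0

/-- The value `ι(ν + ℤ, j)`. -/
def Threshold.value {C : Type*} [Field C] (ι : Threshold C) (ν : C) (j : ℕ) : C := ι.toFun ν j

/-- A series is integral if `μ - ι(μ + ℤ, j)` is a nonnegative integer for every term
`(x - α)^μ log(x - α)^j` with a nonzero coefficient. -/
def IsIntegralSeries {C K : Type*} [Field C] [CharZero C] [Field K] (ι : Threshold C)
    (f : GenSeries C K) : Prop :=
  ∀ (μ : C) (j : ℕ), (expCoeff f μ).coeff j ≠ 0 → ∃ n : ℕ, μ - ι.value μ j = n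

/-! ## Fundamental systems, leading exponents, truncation -/

/-- `f = ∑_{k ≥ 0} f_k(log (x - α)) (x - α)^(ν + k)` with `f_0 ≠ 0`. -/
def HasLeadingExponent {C K : Type*} [Field C] [CharZero C] [Field K] (f : GenSeries C K) (ν : C) :
    Prop :=
  (∀ μ : C, expCoeff f μ ≠ 0 → ∃ k : ℕ, μ = ν + k) ∧ expCoeff f ν ≠ 0

/-- `f ∈ k[[[x - α]]] = ⋃_ν (x - α)^ν k[[x - α]][log (x - α)]`, for an intermediate field `k`. -/
def MemTriple {C K : Type*} [Field C] [CharZero C] [Field K] [Algebra C K]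
    (k : IntermediateField C K) (f : GenSeries C K) : Prop :=
  (∃ ν : C, ∀ μ : C, expCoeff f μ ≠ 0 → ∃ n : ℕ, μ = ν + n) ∧
    ∀ (μ : C) (j : ℕ), (expCoeff f μ).coeff j ∈ k

/-- `b_1, …, b_r` is a fundamental system of `L` at `α`, with coefficients in `k`: as many linearly
independent solutions in `k[[[x - α]]]` as the order of `L`. -/
structure IsFundamentalSystem {C K : Type*} [Field C] [CharZero C] [Field K] [Algebra C K] (α : K)
    (k : IntermediateField C K) (L : DiffOp C) {r : ℕ} (b : Fin r → GenSeries C K) : Prop where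
  ne_zero : L ≠ 0
  order_eq : L.order = r
  mem : ∀ i, MemTriple k (b i)
  solution : ∀ i, act α L (b i) = 0
  linearIndependent : LinearIndependent K b

/-- The Wronskian `det (D^j b_i)` of `b_1, …, b_r`. -/
def seriesWronskian {C K : Type*} [Field C] [CharZero C] [Field K] [Algebra C K] {r : ℕ}
    (b : Fin r → GenSeries C K) : GenSeries C K :=
  Matrix.det (Matrix.of fun i j : Fin r => (serDer C K)^[(j : ℕ)] (b i))

/-- The truncation `∑_{k = 0}^N f_k(log (x - α)) (x - α)^(ν + k)` of
`f = ∑_{k ≥ 0} f_k(log (x - α)) (x - α)^(ν + k)`. -/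
def truncate {C K : Type*} [Field C] [CharZero C] [Field K] (ν : C) (N : ℕ) (f : GenSeries C K) :
    GenSeries C K :=
  ∑ k ∈ Finset.range (N + 1),
    (expCoeff f (ν + k)).map HahnSeries.C * Polynomial.C (powTerm C K (ν + k))

end

noncomputable section

open Polynomial

/-! ## Derivations and matrices -/

/-! Let `W` be the matrix with entries `D^j b_i`, let `E` be the analogous matrix of the remainders
`b_i - t_i`, and let `c` be the column of coefficients of the reduced representative of `B`. The
vectors of series `B · b_i` and `B · t_i` are `W c` and `(W - E) c`. If `W` has inverse `V`, then `E
c = U (W c)` with `U = E V`, so the second vector is `1 - U` applied to the first, with a matrix `U`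
independent of `B`.

The numbers `N_i` are chosen so that every entry of `U` is `x - α` times an integral series.
Products of integral series are integral because `ι` is superadditive. Hence `f - U f` is integral
when `f` is. Conversely, `f = (f - U f) + U f` improves any lower bound for `f` by one, and a lower
bound exists at the start (`integralFrom_iff_sub_mulVec`).

Two facts about `V` control `U`. Exponents: by Liouville's formula (`Derivation.det_of_map_eq_mul`)
the Wronskian solves a first order equation with log-free coefficient. It is therefore log-free and
a unit (`HasLeadingExponent.exists_mul_eq_one`), and the adjugate formula bounds the exponents of
`V` from below, losing exactly `m`. Logarithms: differentiation with respect to the logarithm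
commutes with `D`, so it multiplies `W` from the left by a constant matrix. That matrix is nilpotent
of size `r`, so `V` has logarithmic degree less than `r` (`iterate_derivative_inverse_eq_zero`).
This is why only `k < d_i + r` enters the definition of `N_i`. -/

theorem Matrix.map_derivation_mul {R A n : Type*} [CommRing R] [CommRing A] [Algebra R A]
    [Fintype n] (δ : Derivation R A A) (M N : Matrix n n A) :
    (M * N).map δ = M.map δ * N + M * N.map δ := by
  ext i j
  simp only [Matrix.map_apply, Matrix.mul_apply, Matrix.add_apply, map_sum, Derivation.leibniz,
    smul_eq_mul, ← Finset.sum_add_distrib]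
  exact Finset.sum_congr rfl fun k _ => by ring

theorem Matrix.map_derivation_one {R A n : Type*} [CommRing R] [CommRing A] [Algebra R A]
    [DecidableEq n] (δ : Derivation R A A) : (1 : Matrix n n A).map δ = 0 := by
  ext i j
  rw [Matrix.map_apply, Matrix.one_apply]
  split_ifs <;> simp

/-- The ring homomorphism `a ↦ a + δ a ε` given by a derivation `δ`. -/
def Derivation.toDualNumber {R A : Type*} [CommRing R] [CommRing A] [Algebra R A]
    (δ : Derivation R A A) : A →+* DualNumber A where
  toFun a := TrivSqZeroExt.inl a + TrivSqZeroExt.inr (δ a)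
  map_one' := by rw [Derivation.map_one_eq_zero]; ext <;> simp
  map_zero' := by ext <;> simp
  map_mul' a b := by ext <;> simp [mul_comm]
  map_add' a b := by ext <;> simp

/-- Liouville's formula: if `W' = W A` then `(det W)' = tr A det W`. -/
theorem Derivation.det_of_map_eq_mul {R A n : Type*} [CommRing R] [CommRing A] [Algebra R A]
    [Fintype n] [DecidableEq n] (δ : Derivation R A A) {W M : Matrix n n A}
    (h : W.map δ = W * M) : δ W.det = M.trace * W.det := by
  -- Over the dual numbers the hypothesis becomes `W + ε W' = W (1 + ε M)`. Since `det (1 + ε M) = 1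
  -- + ε tr M`, comparing the `ε`-parts of the determinants gives the formula.
  have h1 : W.map δ.toDualNumber = W.map (algebraMap A (DualNumber A)) *
      (1 + (DualNumber.eps : DualNumber A) • M.map (algebraMap A (DualNumber A))) := by
    rw [mul_add, mul_one, Matrix.mul_smul, ← Matrix.map_mul, ← h]
    ext i j
    · change TrivSqZeroExt.fst (TrivSqZeroExt.inl (W i j) + TrivSqZeroExt.inr (δ (W i j))) =
        TrivSqZeroExt.fst (algebraMap A (DualNumber A) (W i j) +
        DualNumber.eps * algebraMap A (DualNumber A) (δ (W i j)))
      simp [TrivSqZeroExt.algebraMap_eq_inl]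
    · change TrivSqZeroExt.snd (TrivSqZeroExt.inl (W i j) + TrivSqZeroExt.inr (δ (W i j))) =
        TrivSqZeroExt.snd (algebraMap A (DualNumber A) (W i j) +
        DualNumber.eps * algebraMap A (DualNumber A) (δ (W i j)))
      simp [TrivSqZeroExt.algebraMap_eq_inl]
  have h2 := congrArg Matrix.det h1
  rw [Matrix.det_mul, Matrix.det_one_add_smul] at h2
  have h3 : ∀ (f : A →+* DualNumber A), (W.map f).det = f W.det := fun f =>
    (RingHom.map_det f W).symm
  rw [h3, h3, DualNumber.eps_pow_two, mul_zero, add_zero] at h2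
  have h4 := congrArg TrivSqZeroExt.snd h2
  have h5 : (M.map (algebraMap A (DualNumber A))).trace = algebraMap A (DualNumber A) M.trace := by
    simp [Matrix.trace]
  rw [h5] at h4
  simpa [Derivation.toDualNumber, TrivSqZeroExt.algebraMap_eq_inl, mul_comm] using h4

/-- The characteristic polynomial differs from a power of `X` by a nilpotent, hence by zero over a
field; Cayley–Hamilton then applies. -/
theorem Matrix.pow_card_eq_zero_of_isNilpotent {F n : Type*} [Field F] [Fintype n] [DecidableEq n]
    {M : Matrix n n F} (hM : IsNilpotent M) : M ^ Fintype.card n = 0 := by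
  have h := Matrix.isNilpotent_charpoly_sub_pow_of_isNilpotent hM
  have h1 := sub_eq_zero.mp h.eq_zero
  have h2 := Matrix.aeval_self_charpoly M
  rwa [h1, map_pow, aeval_X] at h2

/-! ## Terms of series -/

/-- The term `(x - α)^μ log(x - α)^j` occurs in `f`. -/
def HasTerm {C K : Type*} [Field C] [CharZero C] [Field K] (f : GenSeries C K) (μ : C) (j : ℕ) :
    Prop :=
  (f.coeff j).coeff (Expo.of μ) ≠ 0

section Terms

variable {C K : Type*} [Field C] [CharZero C] [Field K]

theorem HasTerm.of_add {f g : GenSeries C K} {μ : C} {j : ℕ} (h : HasTerm (f + g) μ j) :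
    HasTerm f μ j ∨ HasTerm g μ j := by
  by_contra! h1
  apply h
  rw [coeff_add, HahnSeries.coeff_add, not_ne_iff.mp h1.1, not_ne_iff.mp h1.2, add_zero]

theorem HasTerm.of_mul {f g : GenSeries C K} {μ : C} {j : ℕ} (h : HasTerm (f * g) μ j) :
    ∃ μ₁ μ₂ j₁ j₂, μ₁ + μ₂ = μ ∧ j₁ + j₂ = j ∧ HasTerm f μ₁ j₁ ∧ HasTerm g μ₂ j₂ := by
  unfold HasTerm at h
  rw [coeff_mul, HahnSeries.coeff_sum] at h
  obtain ⟨⟨j₁, j₂⟩, hj, h1⟩ := Finset.exists_ne_zero_of_sum_ne_zero h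
  rw [HahnSeries.coeff_mul] at h1
  obtain ⟨⟨μ₁, μ₂⟩, hμ, h2⟩ := Finset.exists_ne_zero_of_sum_ne_zero h1
  exact ⟨μ₁, μ₂, j₁, j₂, (Finset.mem_antidiagonal.mp hμ).2.2,
    Finset.HasAntidiagonal.mem_antidiagonal.mp hj,
    left_ne_zero_of_mul h2, right_ne_zero_of_mul h2⟩

theorem HasTerm.of_neg {f : GenSeries C K} {μ : C} {j : ℕ} (h : HasTerm (-f) μ j) :
    HasTerm f μ j := by
  intro h1
  apply h
  rw [coeff_neg, HahnSeries.coeff_neg, h1, neg_zero]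

theorem not_hasTerm_zero {μ : C} {j : ℕ} : ¬ HasTerm (0 : GenSeries C K) μ j := by
  simp [HasTerm]

theorem HasTerm.of_sum {ι : Type*} {s : Finset ι} {f : ι → GenSeries C K} {μ : C} {j : ℕ}
    (h : HasTerm (∑ i ∈ s, f i) μ j) : ∃ i ∈ s, HasTerm (f i) μ j := by
  unfold HasTerm at h
  rw [finsetSum_coeff, HahnSeries.coeff_sum] at h
  exact Finset.exists_ne_zero_of_sum_ne_zero h

theorem HasTerm.le_natDegree {f : GenSeries C K} {μ : C} {j : ℕ} (h : HasTerm f μ j) :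
    j ≤ f.natDegree := by
  by_contra! h1
  apply h
  rw [coeff_eq_zero_of_natDegree_lt h1, HahnSeries.coeff_zero]

theorem hasTerm_one {μ : C} {j : ℕ} (h : HasTerm (1 : GenSeries C K) μ j) : μ = 0 ∧ j = 0 := by
  unfold HasTerm at h
  rw [coeff_one] at h
  split_ifs at h with hj
  · rw [HahnSeries.coeff_one] at h
    split_ifs at h with hμ
    · exact ⟨hμ, hj⟩
    · exact absurd rfl h
  · simp at h

/-- All exponents of `f` lie in `e + ℕ`. -/
def SupportedFrom (e : C) (f : GenSeries C K) : Prop :=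
  ∀ μ j, HasTerm f μ j → ∃ n : ℕ, μ = e + n

theorem SupportedFrom.zero {e : C} : SupportedFrom e (0 : GenSeries C K) :=
  fun _ _ h => absurd h not_hasTerm_zero

theorem SupportedFrom.one : SupportedFrom 0 (1 : GenSeries C K) :=
  fun _ _ h => ⟨0, by simp [(hasTerm_one h).1]⟩

theorem SupportedFrom.add {e : C} {f g : GenSeries C K} (hf : SupportedFrom e f)
    (hg : SupportedFrom e g) : SupportedFrom e (f + g) := fun μ j h =>
  h.of_add.elim (hf μ j) (hg μ j)

theorem SupportedFrom.neg {e : C} {f : GenSeries C K} (hf : SupportedFrom e f) :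
    SupportedFrom e (-f) := fun μ j h => hf μ j h.of_neg

theorem SupportedFrom.sum {ι : Type*} {s : Finset ι} {e : C} {f : ι → GenSeries C K}
    (hf : ∀ i ∈ s, SupportedFrom e (f i)) : SupportedFrom e (∑ i ∈ s, f i) := fun μ j h => by
  obtain ⟨i, hi, h1⟩ := h.of_sum
  exact hf i hi μ j h1

theorem SupportedFrom.mul {e e' : C} {f g : GenSeries C K} (hf : SupportedFrom e f)
    (hg : SupportedFrom e' g) : SupportedFrom (e + e') (f * g) := fun μ j h => by
  obtain ⟨μ₁, μ₂, j₁, j₂, rfl, -, h1, h2⟩ := h.of_mul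
  obtain ⟨n₁, rfl⟩ := hf _ _ h1
  obtain ⟨n₂, rfl⟩ := hg _ _ h2
  exact ⟨n₁ + n₂, by push_cast; ring⟩

theorem SupportedFrom.prod {ι : Type*} {s : Finset ι} {e : ι → C} {f : ι → GenSeries C K}
    (hf : ∀ i ∈ s, SupportedFrom (e i) (f i)) :
    SupportedFrom (∑ i ∈ s, e i) (∏ i ∈ s, f i) := by
  classical
  induction s using Finset.induction_on with
  | empty => simpa using SupportedFrom.one
  | insert a s ha ih =>
    rw [Finset.sum_insert ha, Finset.prod_insert ha]
    exact (hf a (Finset.mem_insert_self a s)).mul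
      (ih fun i hi => hf i (Finset.mem_insert_of_mem hi))

theorem SupportedFrom.mono {e : C} {f : GenSeries C K} (n : ℕ) (hf : SupportedFrom (e + n) f) :
    SupportedFrom e f := fun μ j h => by
  obtain ⟨k, rfl⟩ := hf μ j h
  exact ⟨n + k, by push_cast; ring⟩

/-- With weights `ρ` on rows and `σ` on columns, all products in the Leibniz expansion have the same
total weight. -/
theorem SupportedFrom.det {n : Type*} [Fintype n] [DecidableEq n] {ρ σ : n → C}
    {M : Matrix n n (GenSeries C K)} (h : ∀ i j, SupportedFrom (ρ i - σ j) (M i j)) :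
    SupportedFrom (∑ i, ρ i - ∑ j, σ j) M.det := by
  rw [Matrix.det_apply]
  refine SupportedFrom.sum fun τ _ => ?_
  have h1 : SupportedFrom (∑ i, ρ i - ∑ j, σ j) (∏ i, M (τ i) i) := by
    have h2 := SupportedFrom.prod (s := Finset.univ) fun i _ => h (τ i) i
    rwa [Finset.sum_sub_distrib, Equiv.sum_comp τ ρ] at h2
  rcases Int.units_eq_one_or (Equiv.Perm.sign τ) with h3 | h3 <;> rw [h3]
  · rwa [one_smul]
  · rw [Units.neg_smul, one_smul]
    exact h1.neg

/-- The entry is the determinant after row `j` is replaced by the `k`-th unit vector. Giving that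
row the weight `σ k` makes its entry `1` homogeneous of weight zero, and `SupportedFrom.det`
applies. -/
theorem SupportedFrom.adjugate {n : Type*} [Fintype n] [DecidableEq n] {ρ σ : n → C}
    {M : Matrix n n (GenSeries C K)} (h : ∀ i j, SupportedFrom (ρ i - σ j) (M i j)) (k j : n) :
    SupportedFrom (∑ i, ρ i - ∑ i, σ i - (ρ j - σ k)) (M.adjugate k j) := by
  rw [Matrix.adjugate_apply]
  have h1 := SupportedFrom.det (ρ := Function.update ρ j (σ k)) (σ := σ)
    (M := M.updateRow j (Pi.single k 1)) (by
      intro a l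
      by_cases ha : a = j
      · subst ha
        rw [Function.update_self, Matrix.updateRow_self]
        by_cases hl : l = k
        · subst hl
          rw [Pi.single_eq_same, sub_self]
          exact SupportedFrom.one
        · rw [Pi.single_eq_of_ne hl]
          exact SupportedFrom.zero
      · rw [Function.update_of_ne ha, Matrix.updateRow_ne ha]
        exact h a l)
  rw [Finset.sum_update_of_mem (Finset.mem_univ j)] at h1
  rw [← Finset.add_sum_erase _ ρ (Finset.mem_univ j)]
  convert! h1 using 1
  rw [Finset.sdiff_singleton_eq_erase]
  ring

theorem expCoeff_ne_zero_iff {f : GenSeries C K} {μ : C} :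
    expCoeff f μ ≠ 0 ↔ ∃ j, HasTerm f μ j := by
  constructor
  · intro h
    by_contra! h1
    apply h
    ext j
    rw [expCoeff_coeff, not_ne_iff.mp (h1 j), coeff_zero]
  · rintro ⟨j, h⟩ h1
    apply h
    rw [← expCoeff_coeff, h1, coeff_zero]

theorem HasLeadingExponent.supportedFrom {f : GenSeries C K} {e : C}
    (h : HasLeadingExponent f e) : SupportedFrom e f := fun μ j hμ =>
  h.1 μ (expCoeff_ne_zero_iff.mpr ⟨j, hμ⟩)

/-! ## Integrality up to a shift -/

/-- `f` is `(x - α)^s` times an integral series. -/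
def IntegralFrom (ι : Threshold C) (s : ℤ) (f : GenSeries C K) : Prop :=
  ∀ μ j, HasTerm f μ j → ∃ n : ℕ, μ - ι.value μ j = s + n

theorem isIntegralSeries_iff {ι : Threshold C} {f : GenSeries C K} :
    IsIntegralSeries ι f ↔ IntegralFrom ι 0 f := by
  simp only [IsIntegralSeries, IntegralFrom, HasTerm, expCoeff_coeff, Int.cast_zero, zero_add]

theorem IntegralFrom.add {ι : Threshold C} {s : ℤ} {f g : GenSeries C K}
    (hf : IntegralFrom ι s f) (hg : IntegralFrom ι s g) : IntegralFrom ι s (f + g) :=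
  fun μ j h => h.of_add.elim (hf μ j) (hg μ j)

theorem IntegralFrom.neg {ι : Threshold C} {s : ℤ} {f : GenSeries C K}
    (hf : IntegralFrom ι s f) : IntegralFrom ι s (-f) := fun μ j h => hf μ j h.of_neg

theorem IntegralFrom.sum {κ : Type*} {t : Finset κ} {ι : Threshold C} {s : ℤ}
    {f : κ → GenSeries C K} (hf : ∀ i ∈ t, IntegralFrom ι s (f i)) :
    IntegralFrom ι s (∑ i ∈ t, f i) := fun μ j h => by
  obtain ⟨i, hi, h1⟩ := h.of_sum
  exact hf i hi μ j h1

/-- This is what superadditivity of `ι` is for. -/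
theorem IntegralFrom.mul {ι : Threshold C} {s t : ℤ} {f g : GenSeries C K}
    (hf : IntegralFrom ι s f) (hg : IntegralFrom ι t g) : IntegralFrom ι (s + t) (f * g) :=
  fun μ j h => by
    obtain ⟨μ₁, μ₂, j₁, j₂, rfl, rfl, h1, h2⟩ := h.of_mul
    obtain ⟨n₁, hn₁⟩ := hf _ _ h1
    obtain ⟨n₂, hn₂⟩ := hg _ _ h2
    obtain ⟨n, hn⟩ := ι.superadditive μ₁ μ₂ j₁ j₂
    refine ⟨n₁ + n₂ + n, ?_⟩
    unfold Threshold.value at *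
    push_cast
    linear_combination hn₁ + hn₂ + hn

theorem IntegralFrom.mono {ι : Threshold C} {s t : ℤ} {f : GenSeries C K} (hst : t ≤ s)
    (hf : IntegralFrom ι s f) : IntegralFrom ι t f := fun μ j h => by
  obtain ⟨n, hn⟩ := hf μ j h
  obtain ⟨k, rfl⟩ := Int.le.dest hst
  exact ⟨k + n, by rw [hn]; push_cast; ring⟩

theorem Threshold.value_add_intCast {C : Type*} [Field C] (ι : Threshold C) (ν : C)
    (n : ℤ) (j : ℕ) :
    ι.value (ν + n) j = ι.value ν j := by
  unfold Threshold.value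
  congr 1
  refine (QuotientAddGroup.eq.mpr ?_)
  exact ⟨-n, by simp⟩

/-- As `ι` depends on an exponent only modulo the integers, it suffices to test the lowest possible
exponent `e`, once for each power of the logarithm. -/
theorem SupportedFrom.integralFrom {ι : Threshold C} {e : C} {s : ℤ} {f : GenSeries C K}
    (hf : SupportedFrom e f)
    (h : ∀ j ≤ f.natDegree, ∃ n : ℕ, e - ι.value e j = s + n) : IntegralFrom ι s f :=
  fun μ j hμ => by
    obtain ⟨k, rfl⟩ := hf μ j hμ
    obtain ⟨n, hn⟩ := h j hμ.le_natDegree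
    refine ⟨n + k, ?_⟩
    have h1 := ι.value_add_intCast e k j
    rw [Int.cast_natCast] at h1
    rw [h1]
    push_cast
    linear_combination hn

theorem SupportedFrom.exists_integralFrom (ι : Threshold C) {e : C} {f : GenSeries C K}
    (hf : SupportedFrom e f) : ∃ s : ℕ, IntegralFrom ι (-s) f := by
  have h1 : ∀ j, ∃ n : ℤ, e - ι.value e j = n := fun j => by
    obtain ⟨n, hn⟩ := ι.mem_coset e j
    exact ⟨-n, by unfold Threshold.value; rw [hn]; push_cast; ring⟩
  choose z hz using h1
  -- Only finitely many powers of the logarithm occur; the sum is a crude common bound for all `-z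
  -- j`.
  refine ⟨∑ j ∈ Finset.range (f.natDegree + 1), (z j).natAbs, hf.integralFrom fun j hj => ?_⟩
  have h2 : (z j).natAbs ≤ ∑ j ∈ Finset.range (f.natDegree + 1), (z j).natAbs :=
    Finset.single_le_sum (f := fun j => (z j).natAbs) (fun _ _ => Nat.zero_le _)
      (Finset.mem_range.mpr (by omega))
  set S := ∑ j ∈ Finset.range (f.natDegree + 1), (z j).natAbs
  obtain ⟨n, hn⟩ := Int.le.dest (show -(S : ℤ) ≤ z j by omega)
  exact ⟨n, by rw [hz, ← hn]; push_cast; ring⟩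

end Terms

/-! ## Differentiation of series, termwise -/

section Differentiation

variable {C K : Type*} [Field C] [CharZero C] [Field K] [Algebra C K]

theorem coeff_powTerm_mul {C K : Type*} [Field C] [CharZero C] [Field K]
    (f : PowSeries C K) (μ ν : C) :
    (powTerm C K μ * f).coeff (Expo.of (ν + μ)) = f.coeff (Expo.of ν) := by
  rw [powTerm, map_add, HahnSeries.coeff_single_mul_add, one_mul]

theorem coeff_powDer (f : PowSeries C K) (μ : C) :
    (powDer C K f).coeff (Expo.of (μ - 1)) = algebraMap C K μ * f.coeff (Expo.of μ) := by
  change (powTerm C K (-1) * eulerFun f).coeff _ = _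
  rw [sub_eq_add_neg, coeff_powTerm_mul]
  rfl

theorem coeff_serDer (f : GenSeries C K) (j : ℕ) :
    (serDer C K f).coeff j =
      powDer C K (f.coeff j) + powTerm C K (-1) * (f.coeff (j + 1) * ((j : PowSeries C K) + 1)) := by
  have h : serDer C K f =
    coeffwise (powDer C K) f + Polynomial.C (powTerm C K (-1)) * derivative f := rfl
  rw [h, coeff_add, coeff_C_mul, coeffwise_coeff, coeff_derivative]

/-- Leibniz rule on a single term: `(x - α)^μ log^j` goes to `(x - α)^(μ - 1) (μ log^j + j log^(j -
1))`. -/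
theorem coeff_coeff_serDer (f : GenSeries C K) (j : ℕ) (μ : C) :
    ((serDer C K f).coeff j).coeff (Expo.of (μ - 1)) =
      algebraMap C K μ * (f.coeff j).coeff (Expo.of μ) +
        ((j + 1 : ℕ) : K) * (f.coeff (j + 1)).coeff (Expo.of μ) := by
  have h2 : f.coeff (j + 1) * ((j : PowSeries C K) + 1) = (j + 1) • f.coeff (j + 1) := by
    rw [nsmul_eq_mul, mul_comm]
    push_cast
    rfl
  rw [coeff_serDer, HahnSeries.coeff_add, coeff_powDer, h2]
  congr 1
  rw [sub_eq_add_neg, coeff_powTerm_mul, HahnSeries.coeff_nsmul, Pi.smul_apply, nsmul_eq_mul]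

theorem natDegree_serDer_le (f : GenSeries C K) : (serDer C K f).natDegree ≤ f.natDegree := by
  refine natDegree_le_iff_coeff_eq_zero.mpr fun j hj => ?_
  rw [coeff_serDer, coeff_eq_zero_of_natDegree_lt hj,
    coeff_eq_zero_of_natDegree_lt (by omega : f.natDegree < j + 1)]
  simp

theorem natDegree_iterate_serDer_le (f : GenSeries C K) (k : ℕ) :
    ((serDer C K)^[k] f).natDegree ≤ f.natDegree := by
  induction k with
  | zero => exact le_rfl
  | succ k ih =>
    rw [Function.iterate_succ_apply']
    exact (natDegree_serDer_le _).trans ih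

theorem SupportedFrom.serDer {e : C} {f : GenSeries C K} (hf : SupportedFrom e f) :
    SupportedFrom (e - 1) (serDer C K f) := fun μ j h => by
  have h1 := coeff_coeff_serDer f j (μ + 1)
  rw [add_sub_cancel_right] at h1
  unfold HasTerm at h
  rw [h1] at h
  have h2 : ∃ i, HasTerm f (μ + 1) i := by
    by_contra! h3
    apply h
    rw [not_ne_iff.mp (h3 j), not_ne_iff.mp (h3 (j + 1)), mul_zero, mul_zero, add_zero]
  obtain ⟨i, hi⟩ := h2
  obtain ⟨n, hn⟩ := hf _ _ hi
  exact ⟨n, by linear_combination hn⟩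

theorem SupportedFrom.iterate_serDer {e : C} {f : GenSeries C K} (hf : SupportedFrom e f) (k : ℕ) :
    SupportedFrom (e - k) ((_root_.serDer C K)^[k] f) := by
  induction k with
  | zero => simpa using hf
  | succ k ih =>
    rw [Function.iterate_succ_apply']
    convert! ih.serDer using 1
    push_cast
    ring

/-- The derivation `D` sends the logarithm to a log-free series, so the formal derivative with
respect to the logarithm commutes with it. -/
theorem derivative_serDer (f : GenSeries C K) :
    derivative (serDer C K f) = serDer C K (derivative f) := by
  have h : ∀ g : GenSeries C K, serDer C K g =
    coeffwise (powDer C K) g + Polynomial.C (powTerm C K (-1)) * derivative g := fun _ => rfl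
  rw [h, h, derivative_add, derivative_C_mul]
  congr 1
  ext1 j
  rw [coeff_derivative, coeffwise_coeff, coeffwise_coeff, coeff_derivative, ← Nat.cast_succ,
    Derivation.leibniz, Derivation.map_natCast, smul_zero, zero_add, smul_eq_mul, mul_comm]

/-- The constants of the differential ring of series. -/
theorem eq_C_of_serDer_eq_zero {f : GenSeries C K} (hf : serDer C K f = 0) :
    ∃ c : K, f = Polynomial.C (HahnSeries.C c) := by
  have : CharZero K := charZero_of_injective_algebraMap (algebraMap C K).injective
  have key : ∀ (j : ℕ) (μ : C), algebraMap C K μ * (f.coeff j).coeff (Expo.of μ) +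
      ((j + 1 : ℕ) : K) * (f.coeff (j + 1)).coeff (Expo.of μ) = 0 := fun j μ => by
    rw [← coeff_coeff_serDer, hf, coeff_zero, HahnSeries.coeff_zero]
  have h0 : ∀ j, (f.coeff (j + 1)).coeff (Expo.of 0) = 0 := fun j => by
    have h := key j 0
    rw [map_zero, zero_mul, zero_add] at h
    exact (mul_eq_zero.mp h).resolve_left (by exact_mod_cast Nat.succ_ne_zero j)
  -- For `μ ≠ 0` the recurrence determines the coefficient of `log^j` from that of `log^(j + 1)`;
  -- descending from above the degree, all vanish.
  have h1 : ∀ μ : C, μ ≠ 0 → ∀ k j, f.natDegree < j + k → (f.coeff j).coeff (Expo.of μ) = 0 := by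
    intro μ hμ k
    induction k with
    | zero =>
      intro j hj
      rw [coeff_eq_zero_of_natDegree_lt (by omega), HahnSeries.coeff_zero]
    | succ k ih =>
      intro j hj
      have h := key j μ
      rw [ih (j + 1) (by omega), mul_zero, add_zero] at h
      exact (mul_eq_zero.mp h).resolve_left
        ((map_ne_zero_iff _ (algebraMap C K).injective).mpr hμ)
  refine ⟨(f.coeff 0).coeff (Expo.of 0), ?_⟩
  ext j μ
  obtain ⟨μ, rfl⟩ : ∃ μ' : C, Expo.of μ' = μ := ⟨μ, rfl⟩
  by_cases hμ : μ = 0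
  · subst hμ
    cases j with
    | zero => rw [coeff_C_zero, HahnSeries.C_apply, map_zero, HahnSeries.coeff_single_same]
    | succ j => rw [h0, coeff_C_succ, HahnSeries.coeff_zero]
  · rw [h1 μ hμ (f.natDegree + 1) j (by omega)]
    cases j with
    | zero =>
      rw [coeff_C_zero, HahnSeries.C_apply, HahnSeries.coeff_single_of_ne]
      exact hμ
    | succ j => rw [coeff_C_succ, HahnSeries.coeff_zero]

end Differentiation

/-! ## Units -/

section Units

variable {C K : Type*} [Field C] [CharZero C] [Field K]

theorem coeff_laurentToPow_intCast (f : LaurentSeries K) (n : ℤ) :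
    (laurentToPow C K f).coeff (Expo.of (n : C)) = f.coeff n :=
  HahnSeries.embDomain_coeff (a := n)

theorem exists_of_coeff_laurentToPow_ne_zero {f : LaurentSeries K} {μ : C}
    (h : (laurentToPow C K f).coeff (Expo.of μ) ≠ 0) : ∃ n : ℤ, μ = n ∧ f.coeff n ≠ 0 := by
  obtain ⟨n, hn, h1⟩ := HahnSeries.support_embDomain_subset h
  exact ⟨n, h1.symm, hn⟩

theorem SupportedFrom.C_laurentToPow (f : LaurentSeries K) :
    SupportedFrom (f.order : C) (Polynomial.C (laurentToPow C K f) : GenSeries C K) := by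
  intro μ j h
  unfold HasTerm at h
  rw [coeff_C] at h
  split_ifs at h
  · obtain ⟨n, rfl, hn⟩ := exists_of_coeff_laurentToPow_ne_zero h
    obtain ⟨k, rfl⟩ := Int.le.dest (HahnSeries.order_le_of_coeff_ne_zero hn)
    exact ⟨k, by push_cast; rfl⟩
  · simp at h

theorem SupportedFrom.C_expandRat [Algebra C K] (α : K) (a : RatFunc C) :
    ∃ s : ℤ, SupportedFrom (s : C) (Polynomial.C (expandRat α a) : GenSeries C K) :=
  ⟨_, SupportedFrom.C_laurentToPow _⟩

theorem powTerm_mul_powTerm (μ ν : C) :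
    powTerm C K μ * powTerm C K ν = powTerm C K (μ + ν) := by
  rw [powTerm, powTerm, HahnSeries.single_mul_single, one_mul, ← map_add]
  rfl

theorem powTerm_zero : powTerm C K 0 = 1 := by
  rw [powTerm, map_zero]
  rfl

theorem SupportedFrom.C_powTerm (μ : C) :
    SupportedFrom μ (Polynomial.C (powTerm C K μ) : GenSeries C K) := by
  intro μ' j h
  unfold HasTerm at h
  rw [coeff_C] at h
  split_ifs at h
  · rw [powTerm, HahnSeries.coeff_single] at h
    split_ifs at h with h1
    · exact ⟨0, by rw [Nat.cast_zero, add_zero]; exact h1⟩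
    · exact absurd rfl h
  · simp at h

/-- A log-free series with leading exponent `e` is a unit. -/
theorem exists_mul_eq_one_of_supportedFrom {f : PowSeries C K} {e : C}
    (hf : SupportedFrom e (Polynomial.C f)) (h0 : f.coeff (Expo.of e) ≠ 0) :
    ∃ g : PowSeries C K, f * g = 1 ∧ SupportedFrom (-e) (Polynomial.C g) := by
  set φ : PowerSeries K →+* PowSeries C K :=
    (laurentToPow C K).comp (HahnSeries.ofPowerSeries ℤ K) with hφ
  have hφn : ∀ (p : PowerSeries K) (n : ℕ),
      (φ p).coeff (Expo.of (n : C)) = PowerSeries.coeff n p := fun p n => by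
    have h := coeff_laurentToPow_intCast (C := C) (HahnSeries.ofPowerSeries ℤ K p) n
    rw [Int.cast_natCast] at h
    rw [hφ, RingHom.comp_apply, h]
    exact HahnSeries.ofPowerSeries_apply_coeff p n
  have hφs : ∀ p : PowerSeries K, SupportedFrom 0 (Polynomial.C (φ p)) := fun p μ j h => by
    unfold HasTerm at h
    rw [coeff_C] at h
    split_ifs at h
    · obtain ⟨n, rfl, hn⟩ := exists_of_coeff_laurentToPow_ne_zero h
      obtain ⟨l, -, rfl⟩ := HahnSeries.support_embDomain_subset hn
      exact ⟨l, by simp⟩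
    · simp at h
  -- Dividing by `(x - α)^e` leaves an ordinary power series with nonzero constant term, which is
  -- invertible.
  set p : PowerSeries K := PowerSeries.mk fun n => f.coeff (Expo.of (e + n)) with hp
  have hfp : f = powTerm C K e * φ p := by
    ext μ
    obtain ⟨μ, rfl⟩ : ∃ μ' : C, Expo.of (e + μ') = μ :=
      ⟨Expo.val μ - e, by rw [add_sub_cancel]; rfl⟩
    rw [add_comm e μ, coeff_powTerm_mul, add_comm μ e]
    by_cases hμ : ∃ n : ℕ, μ = n
    · obtain ⟨n, rfl⟩ := hμ
      rw [hφn, hp, PowerSeries.coeff_mk]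
    · have h2 : f.coeff (Expo.of (e + μ)) = 0 := by
        by_contra h
        obtain ⟨n, hn⟩ := hf (e + μ) 0 (by unfold HasTerm; rwa [coeff_C_zero])
        exact hμ ⟨n, add_left_cancel hn⟩
      have h3 : (φ p).coeff (Expo.of μ) = 0 := by
        by_contra h
        obtain ⟨n, hn⟩ := hφs p μ 0 (by unfold HasTerm; rwa [coeff_C_zero])
        exact hμ ⟨n, by rw [hn, zero_add]⟩
      rw [h2, h3]
  have hp0 : PowerSeries.constantCoeff p ≠ 0 := by
    rw [← PowerSeries.coeff_zero_eq_constantCoeff_apply, hp, PowerSeries.coeff_mk]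
    simpa using h0
  refine ⟨powTerm C K (-e) * φ p⁻¹, ?_, ?_⟩
  · rw [hfp, mul_mul_mul_comm, powTerm_mul_powTerm, add_neg_cancel, powTerm_zero, one_mul,
      ← map_mul, PowerSeries.mul_inv_cancel p hp0, map_one]
  · rw [map_mul]
    simpa using (SupportedFrom.C_powTerm (-e)).mul (hφs p⁻¹)

/-- A solution of a first order equation `w' = a w` with log-free `a` that has a leading exponent
is a unit, and its inverse has the opposite exponent. -/
theorem HasLeadingExponent.exists_mul_eq_one [Algebra C K] {w : GenSeries C K} {e : C}
    (hw : HasLeadingExponent w e) {a : PowSeries C K}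
    (ha : serDer C K w = Polynomial.C a * w) :
    ∃ v : GenSeries C K, w * v = 1 ∧ SupportedFrom (-e) v := by
  have : CharZero K := charZero_of_injective_algebraMap (algebraMap C K).injective
  have hs := hw.supportedFrom
  obtain ⟨j₀, hj₀⟩ := expCoeff_ne_zero_iff.mp hw.2
  have hc : ∀ j, SupportedFrom e (Polynomial.C (w.coeff j)) := fun j μ i h => by
    unfold HasTerm at h
    rw [coeff_C] at h
    split_ifs at h
    · exact hs μ j h
    · simp at h
  -- If the logarithmic degree were `d + 1`, the top coefficients would satisfy `w_(d+1)' = a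
  -- w_(d+1)` and `w_d' + (d + 1) (x - α)^(-1) w_(d+1) = a w_d`. Their quotient would then be a
  -- log-free antiderivative of `-(d + 1) (x - α)^(-1)`, which does not exist.
  have hdeg : w.natDegree = 0 := by
    by_contra hd
    obtain ⟨d, hd⟩ := Nat.exists_eq_succ_of_ne_zero hd
    have hwd : w.coeff (d + 1) ≠ 0 := by
      rw [← Nat.succ_eq_add_one, ← hd]
      intro h
      rw [leadingCoeff_eq_zero.mp h] at hj₀
      exact not_hasTerm_zero hj₀
    obtain ⟨g, hg⟩ : ∃ g, w.coeff (d + 1) * g = 1 := by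
      -- The lowest exponent of the top coefficient may lie strictly above `e`, so it is located
      -- first.
      have hex : ∃ n : ℕ, (w.coeff (d + 1)).coeff (Expo.of (e + n)) ≠ 0 := by
        by_contra! h
        apply hwd
        ext μ
        by_contra h1
        obtain ⟨n, hn⟩ := hs (Expo.val μ) (d + 1) h1
        exact h1 (by rw [HahnSeries.coeff_zero]; have := h n; rwa [← hn] at this)
      classical
      obtain ⟨g, hg, -⟩ := exists_mul_eq_one_of_supportedFrom (e := e + Nat.find hex) (by
        intro μ i h
        obtain ⟨n, rfl⟩ := hc (d + 1) μ i h
        unfold HasTerm at h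
        rw [coeff_C] at h
        split_ifs at h
        · obtain ⟨k, rfl⟩ := Nat.exists_eq_add_of_le (Nat.find_min' hex h)
          exact ⟨k, by push_cast; ring⟩
        · simp at h) (Nat.find_spec hex)
      exact ⟨g, hg⟩
    have h1 : powDer C K (w.coeff (d + 1)) = a * w.coeff (d + 1) := by
      rw [← coeff_C_mul, ← ha, coeff_serDer,
        coeff_eq_zero_of_natDegree_lt (by omega : w.natDegree < d + 1 + 1), zero_mul, mul_zero,
        add_zero]
    have h2 : powDer C K (w.coeff d) + powTerm C K (-1) * (w.coeff (d + 1) * (d + 1)) =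
        a * w.coeff d := by
      rw [← coeff_C_mul, ← ha, coeff_serDer]
    have h3 : w.coeff (d + 1) * powDer C K g + g * powDer C K (w.coeff (d + 1)) = 0 := by
      have h := (powDer C K).leibniz (w.coeff (d + 1)) g
      rw [hg, Derivation.map_one_eq_zero, smul_eq_mul, smul_eq_mul] at h
      exact h.symm
    have h4 : powDer C K (w.coeff d * g) = -((d + 1 : ℕ) • powTerm C K (-1)) := by
      rw [Derivation.leibniz, smul_eq_mul, smul_eq_mul, nsmul_eq_mul]
      push_cast
      linear_combination (w.coeff d * g) * h3 - (w.coeff d * powDer C K g +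
        powTerm C K (-1) * (d + 1) + w.coeff d * g * a) * hg +
        g * h2 - w.coeff d * g * g * h1
    -- The coefficient of `(x - α)^(-1)` in the derivative of a log-free series is zero.
    have h5 := coeff_powDer (w.coeff d * g) (0 : C)
    rw [h4, zero_sub, map_zero, zero_mul, HahnSeries.coeff_neg, HahnSeries.coeff_nsmul, powTerm,
      Pi.smul_apply, HahnSeries.coeff_single_same, neg_eq_zero, nsmul_eq_mul, mul_one, Nat.cast_eq_zero] at h5
    omega
  have hw0 := eq_C_of_natDegree_eq_zero hdeg
  have hj0 : j₀ = 0 := by have := hj₀.le_natDegree; omega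
  subst hj0
  obtain ⟨g, hg, hg'⟩ := exists_mul_eq_one_of_supportedFrom (hc 0) hj₀
  exact ⟨Polynomial.C g, by rw [hw0, ← map_mul, hg, map_one], hg'⟩

end Units

/-! ## Truncation -/

section Truncation

variable {C K : Type*} [Field C] [CharZero C] [Field K]

open Classical in
theorem coeff_coeff_truncate (f : GenSeries C K) (ν : C) (N : ℕ) (μ : C) (j : ℕ) :
    ((truncate ν N f).coeff j).coeff (Expo.of μ) =
      if ∃ k ≤ N, μ = ν + k then (f.coeff j).coeff (Expo.of μ) else 0 := by
  have h : ∀ k : ℕ, (((expCoeff f (ν + k)).map HahnSeries.C *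
      Polynomial.C (powTerm C K (ν + k))).coeff j).coeff (Expo.of μ) =
      if μ = ν + k then (f.coeff j).coeff (Expo.of μ) else 0 := fun k => by
    rw [coeff_mul_C, coeff_map, expCoeff_coeff, HahnSeries.C_mul_eq_smul, HahnSeries.coeff_smul,
      powTerm, HahnSeries.coeff_single]
    by_cases hk : μ = ν + k
    · rw [if_pos (congrArg Expo.of hk), if_pos hk, hk, smul_eq_mul, mul_one]
    · rw [if_neg fun h => hk (Expo.of.injective h), if_neg hk, smul_zero]
  rw [truncate, finsetSum_coeff, HahnSeries.coeff_sum, Finset.sum_congr rfl fun k _ => h k]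
  split_ifs with h1
  · obtain ⟨k, hk, rfl⟩ := h1
    rw [Finset.sum_eq_single k, if_pos rfl]
    · intro l _ hl
      rw [if_neg]
      intro h2
      exact hl (by exact_mod_cast (add_left_cancel h2).symm)
    · intro h2
      exact absurd (Finset.mem_range.mpr (by omega)) h2
  · refine Finset.sum_eq_zero fun k hk => if_neg fun h2 => h1 ⟨k, ?_, h2⟩
    have := Finset.mem_range.mp hk
    omega

theorem HasTerm.of_sub_truncate {f : GenSeries C K} {ν : C} {N : ℕ} {μ : C} {j : ℕ}
    (h : HasTerm (f - truncate ν N f) μ j) : HasTerm f μ j ∧ ∀ k ≤ N, μ ≠ ν + k := by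
  classical
  unfold HasTerm at h
  rw [coeff_sub, HahnSeries.coeff_sub, coeff_coeff_truncate] at h
  split_ifs at h with h1
  · rw [sub_self] at h
    exact absurd rfl h
  · rw [sub_zero] at h
    exact ⟨h, fun k hk h2 => h1 ⟨k, hk, h2⟩⟩

/-- The term of index `N` is kept by the truncation; the resulting `+ 1` is what makes `U` divisible
by `x - α`. -/
theorem SupportedFrom.sub_truncate {f : GenSeries C K} {ν : C} (hf : SupportedFrom ν f) (N : ℕ) :
    SupportedFrom (ν + N + 1) (f - truncate ν N f) := fun μ j h => by
  obtain ⟨h1, h2⟩ := h.of_sub_truncate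
  obtain ⟨n, rfl⟩ := hf μ j h1
  obtain ⟨k, rfl⟩ := Nat.exists_eq_add_of_lt (not_le.mp fun hn => h2 n hn rfl)
  exact ⟨k, by push_cast; ring⟩

theorem natDegree_sub_truncate_le (f : GenSeries C K) (ν : C) (N : ℕ) :
    (f - truncate ν N f).natDegree ≤ f.natDegree := by
  refine natDegree_le_iff_coeff_eq_zero.mpr fun j hj => ?_
  ext μ
  by_contra h
  have h1 := (HasTerm.of_sub_truncate (μ := Expo.val μ) h).1.le_natDegree
  omega

theorem SupportedFrom.natDegree_le {f : GenSeries C K} {ν : C} (hf : SupportedFrom ν f) {d : ℕ}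
    (hd : ∀ k : ℕ, (expCoeff f (ν + k)).natDegree ≤ d) : f.natDegree ≤ d := by
  refine natDegree_le_iff_coeff_eq_zero.mpr fun j hj => ?_
  ext μ
  by_contra h
  obtain ⟨k, hk⟩ := hf (Expo.val μ) j h
  apply h
  have h1 := expCoeff_coeff f (ν + k) j
  rw [← hk, coeff_eq_zero_of_natDegree_lt] at h1
  · exact h1.symm
  · rw [hk]
    exact (hd k).trans_lt hj

end Truncation

/-! ## Fundamental matrices -/

section FundamentalMatrix

variable {C K : Type*} [Field C] [CharZero C] [Field K] [Algebra C K]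

theorem act_eq_sum (α : K) {P : DiffOp C} {n : ℕ} (hP : ∀ i, n ≤ i → P.coeff i = 0)
    (f : GenSeries C K) :
    act α P f = ∑ k ∈ Finset.range n,
      Polynomial.C (expandRat α (P.coeff k)) * (serDer C K)^[k] f := by
  rw [act, Polynomial.sum_def]
  refine Finset.sum_subset (fun i hi => ?_) fun i _ hi => ?_
  · by_contra h
    exact mem_support_iff.mp hi (hP i (by simpa using h))
  · rw [notMem_support_iff.mp hi, map_zero, map_zero, zero_mul]

/-- The matrix `(D^j b_i)`. -/
def wronskianMatrix {r : ℕ} (b : Fin r → GenSeries C K) : Matrix (Fin r) (Fin r) (GenSeries C K) :=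
  Matrix.of fun i j => (serDer C K)^[(j : ℕ)] (b i)

theorem wronskianMatrix_apply {r : ℕ} (b : Fin r → GenSeries C K) (i j : Fin r) :
    wronskianMatrix b i j = (serDer C K)^[(j : ℕ)] (b i) := rfl

theorem act_eq_mulVec (α : K) {r : ℕ} {P : DiffOp C} (hP : ∀ i, r ≤ i → P.coeff i = 0)
    (b : Fin r → GenSeries C K) (i : Fin r) :
    act α P (b i) =
      (wronskianMatrix b).mulVec (fun k => Polynomial.C (expandRat α (P.coeff k))) i := by
  rw [act_eq_sum α hP, Finset.sum_range]
  exact Finset.sum_congr rfl fun k _ => mul_comm _ _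

/-- The companion system satisfied by the matrix `(D^j b_i)` of a system of solutions. -/
theorem exists_map_serDer_eq_mul {α : K} {L : DiffOp C} (hL : L ≠ 0) {r : ℕ} (hr : L.order = r)
    {b : Fin r → GenSeries C K} (hb : ∀ i, act α L (b i) = 0) :
    ∃ A : Matrix (Fin r) (Fin r) (PowSeries C K),
      (wronskianMatrix b).map (serDer C K) = wronskianMatrix b * A.map Polynomial.C := by
  have hlc : L.coeff r ≠ 0 := by
    intro h
    apply hL
    rw [← hr] at h
    exact (leadingCoeff_eq_zero (p := L.toPoly)).mp h
  have hL0 : ∀ i, r + 1 ≤ i → L.coeff i = 0 := fun i hi =>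
    coeff_eq_zero_of_natDegree_lt (p := L.toPoly) (by unfold DiffOp.order at hr; omega)
  set u : PowSeries C K := expandRat α (L.coeff r)⁻¹ with hu
  have hu1 : u * expandRat α (L.coeff r) = 1 := by
    rw [hu, ← map_mul, inv_mul_cancel₀ hlc, map_one]
  have htop : ∀ i, (serDer C K)^[r] (b i) = ∑ k : Fin r, (serDer C K)^[(k : ℕ)] (b i) *
      Polynomial.C (-(u * expandRat α (L.coeff k))) := by
    intro i
    have h := hb i
    rw [act_eq_sum α hL0, Finset.sum_range_succ, Finset.sum_range] at h
    have h1 : Polynomial.C u * Polynomial.C (expandRat α (L.coeff r)) = 1 := by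
      rw [← map_mul, hu1, map_one]
    have h2 : ∑ k : Fin r, (serDer C K)^[(k : ℕ)] (b i) *
        Polynomial.C (-(u * expandRat α (L.coeff k))) = -(Polynomial.C u *
        ∑ k : Fin r, Polynomial.C (expandRat α (L.coeff k)) * (serDer C K)^[(k : ℕ)] (b i)) := by
      rw [Finset.mul_sum, ← Finset.sum_neg_distrib]
      refine Finset.sum_congr rfl fun k _ => ?_
      rw [map_neg, map_mul]
      ring
    rw [h2]
    linear_combination Polynomial.C u * h - (serDer C K)^[r] (b i) * h1
  -- Column `k` of the Wronskian matrix differentiates to column `k + 1`, except that the last one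
  -- is rewritten by the equation divided by its leading coefficient. The solutions are the rows, so
  -- the companion matrix acts from the right.
  refine ⟨Matrix.of fun l k => if (k : ℕ) + 1 = r then -(u * expandRat α (L.coeff l)) else
    if (l : ℕ) = k + 1 then 1 else 0, ?_⟩
  ext1 i k
  rw [Matrix.map_apply, wronskianMatrix_apply, ← Function.iterate_succ_apply' (serDer C K),
    Matrix.mul_apply]
  simp only [wronskianMatrix_apply, Matrix.map_apply, Matrix.of_apply]
  by_cases hk : (k : ℕ) + 1 = r
  · simp only [if_pos hk]
    rw [← htop, Nat.succ_eq_add_one, hk]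
  · simp only [if_neg hk]
    have hk' : (k : ℕ) + 1 < r := by omega
    rw [Finset.sum_eq_single ⟨(k : ℕ) + 1, hk'⟩]
    · simp
    · intro l _ hl
      rw [if_neg fun h => hl (Fin.ext h), map_zero, mul_zero]
    · exact fun h => absurd (Finset.mem_univ _) h

theorem Matrix.map_derivative_mul {R n : Type*} [CommRing R] [Fintype n] (M N : Matrix n n R[X]) :
    (M * N).map derivative = M.map derivative * N + M * N.map derivative :=
  Matrix.map_derivation_mul (derivative' (R := R)) M N

theorem HasTerm.lt_of_iterate_derivative_eq_zero {f : GenSeries C K} {n : ℕ}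
    (h : derivative^[n] f = 0) {μ : C} {j : ℕ} (hj : HasTerm f μ j) : j < n := by
  have : CharZero K := charZero_of_injective_algebraMap (algebraMap C K).injective
  by_contra! hn
  obtain ⟨k, rfl⟩ := Nat.exists_eq_add_of_le' hn
  have h1 := coeff_iterate_derivative (k := n) f k
  rw [h, coeff_zero] at h1
  have h2 := congrArg (fun g : PowSeries C K => g.coeff (Expo.of μ)) h1
  simp only [HahnSeries.coeff_zero, HahnSeries.coeff_nsmul, Pi.smul_apply] at h2
  rw [nsmul_eq_mul] at h2
  rcases mul_eq_zero.mp h2.symm with h3 | h3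
  · rw [Nat.cast_eq_zero, Nat.descFactorial_eq_zero_iff_lt] at h3
    omega
  · exact hj h3

/-- The inverse of a fundamental matrix of size `r` of a log-free system has logarithms of degree
less than `r`. -/
theorem iterate_derivative_inverse_eq_zero {r : ℕ} {W V : Matrix (Fin r) (Fin r) (GenSeries C K)}
    {A : Matrix (Fin r) (Fin r) (PowSeries C K)}
    (hA : W.map (serDer C K) = W * A.map Polynomial.C) (hWV : W * V = 1) (i j : Fin r) :
    derivative^[r] (V i j) = 0 := by
  have hVW : V * W = 1 := mul_eq_one_comm.mp hWV
  obtain ⟨W', hW'⟩ : ∃ W', W' = W.map derivative := ⟨_, rfl⟩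
  -- The logarithmic derivative `W'` solves the same system because `A` is log-free.
  have hcomm : W'.map (serDer C K) = W' * A.map Polynomial.C := by
    have h1 : W'.map (serDer C K) = (W.map (serDer C K)).map derivative := by
      ext1 i j
      rw [hW']
      exact (derivative_serDer _).symm
    have h2 : (A.map Polynomial.C).map derivative = 0 := by
      ext1 i j
      exact derivative_C
    rw [h1, hA, Matrix.map_derivative_mul, h2, mul_zero, add_zero, hW']
  obtain ⟨M, hM⟩ : ∃ M, M = W' * V := ⟨_, rfl⟩
  have hMW : W' = M * W := by rw [hM, mul_assoc, hVW, mul_one]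
  -- Two solution matrices of one system differ by a constant factor: differentiating `W' = M W`
  -- leaves `(D M) W = 0`, and `W` is invertible.
  have hM0 : M.map (serDer C K) = 0 := by
    have h1 := Matrix.map_derivation_mul (serDer C K) M W
    rw [← hMW, hcomm, hA, ← mul_assoc M, ← hMW] at h1
    have h2 := right_eq_add.mp h1
    have h3 := congrArg (· * V) h2
    simpa only [mul_assoc, hWV, mul_one, zero_mul] using h3
  have hconst : ∀ i j, ∃ c : K, M i j = Polynomial.C (HahnSeries.C c) := fun i j =>
    eq_C_of_serDer_eq_zero (congrFun (congrFun hM0 i) j)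
  choose c hc using hconst
  set φ : K →+* GenSeries C K := Polynomial.C.comp HahnSeries.C with hφ
  have hφ_inj : Function.Injective φ := φ.injective
  have hMc : M = φ.mapMatrix (Matrix.of c) := by
    ext1 i j
    exact hc i j
  have hMder : ∀ n, (M ^ n).map derivative = 0 := fun n => by
    rw [hMc, ← map_pow]
    ext1 i j
    exact derivative_C
  have hpow : ∀ n, W.map derivative^[n] = M ^ n * W := by
    intro n
    induction n with
    | zero => rw [pow_zero, one_mul]; rfl
    | succ n ih =>
      have h1 : W.map derivative^[n + 1] = (W.map derivative^[n]).map derivative := by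
        ext1 i j
        exact Function.iterate_succ_apply' _ _ _
      rw [h1, ih, Matrix.map_derivative_mul, hMder, zero_mul, zero_add, ← hW', hMW, ← mul_assoc,
        pow_succ]
  -- The `n`-th logarithmic derivative of `W` is `M^n W`. It vanishes once `n` exceeds all
  -- logarithmic degrees, and `W` is invertible.
  have hnil : IsNilpotent (Matrix.of c) := by
    refine ⟨∑ i, ∑ j, ((W i j).natDegree + 1), ?_⟩
    set n := ∑ i, ∑ j, ((W i j).natDegree + 1) with hn
    have h1 : W.map derivative^[n] = 0 := by
      ext1 i j
      refine iterate_derivative_eq_zero ?_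
      have h2 : (W i j).natDegree + 1 ≤ ∑ j, ((W i j).natDegree + 1) :=
        Finset.single_le_sum (f := fun j => (W i j).natDegree + 1) (fun _ _ => Nat.zero_le _)
          (Finset.mem_univ j)
      have h3 : ∑ j, ((W i j).natDegree + 1) ≤ n :=
        Finset.single_le_sum (f := fun i => ∑ j, ((W i j).natDegree + 1))
          (fun _ _ => Nat.zero_le _) (Finset.mem_univ i)
      omega
    rw [hpow] at h1
    have h2 := congrArg (· * V) h1
    simp only [mul_assoc, hWV, mul_one, zero_mul] at h2
    rw [hMc, ← map_pow] at h2
    ext i j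
    exact hφ_inj ((congrFun (congrFun h2 i) j).trans (map_zero φ).symm)
  obtain ⟨P, hP⟩ : ∃ P, P = φ.mapMatrix (-Matrix.of c) := ⟨_, rfl⟩
  have hPr : P ^ r = 0 := by
    have h := Matrix.pow_card_eq_zero_of_isNilpotent hnil.neg
    rw [Fintype.card_fin] at h
    rw [hP, ← map_pow, h, map_zero]
  have hPder : ∀ n, (P ^ n).map derivative = 0 := fun n => by
    rw [hP, ← map_pow]
    ext1 i j
    exact derivative_C
  have hPM : P + M = 0 := by rw [hP, hMc, ← map_add, neg_add_cancel, map_zero]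
  -- Differentiating `V W = 1` with respect to the logarithm gives `-V M`, so the `r`-th derivative
  -- of `V` is `V (-M)^r = 0`.
  have hV' : V.map derivative = V * P := by
    have h1 := Matrix.map_derivative_mul V W
    have h0 : (1 : Matrix (Fin r) (Fin r) (GenSeries C K)).map derivative = 0 :=
      Matrix.map_derivation_one (derivative' (R := PowSeries C K))
    rw [hVW, h0, ← hW'] at h1
    have h2 := congrArg (· * V) h1
    simp only [add_mul, mul_assoc, hWV, mul_one, zero_mul, ← hM] at h2
    have h3 : V * P + V * M = 0 := by rw [← mul_add, hPM, mul_zero]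
    exact add_right_cancel (h2.symm.trans h3.symm)
  have hVpow : ∀ n, V.map derivative^[n] = V * P ^ n := by
    intro n
    induction n with
    | zero => rw [pow_zero, mul_one]; rfl
    | succ n ih =>
      have h1 : V.map derivative^[n + 1] = (V.map derivative^[n]).map derivative := by
        ext1 i j
        exact Function.iterate_succ_apply' _ _ _
      rw [h1, ih, Matrix.map_derivative_mul, hPder, mul_zero, add_zero, hV', pow_succ',
        ← mul_assoc]
  have h := congrFun (congrFun (hVpow r) i) j
  rw [hPr, mul_zero] at h
  exact h

end FundamentalMatrix

/-! ## Comparison of a series with its truncation -/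

section Comparison

variable {C K : Type*} [Field C] [CharZero C] [Field K] [Algebra C K]

/-- Together with `SupportedFrom.exists_integralFrom`, this supplies the initial lower bound from
which the successive improvement starts. -/
theorem SupportedFrom.exists_act (α : K) {e : C} {f : GenSeries C K} (hf : SupportedFrom e f)
    (P : DiffOp C) : ∃ s : ℤ, SupportedFrom (e + s) (act α P f) := by
  choose s hs using fun k => SupportedFrom.C_expandRat (K := K) α (P.coeff k)
  have hP : ∀ i, P.order + 1 ≤ i → P.coeff i = 0 := fun i hi =>
    coeff_eq_zero_of_natDegree_lt (p := P.toPoly) hi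
  rw [act_eq_sum α hP]
  set n := P.order + 1
  have hlow : ∃ t : ℤ, ∀ k ∈ Finset.range n, t ≤ s k - k :=
    by
    obtain ⟨t, ht⟩ := ((Finset.range n).image fun k : ℕ => s k - k).bddBelow
    exact ⟨t, fun k hk => ht (Finset.mem_coe.mpr (Finset.mem_image_of_mem _ hk))⟩
  obtain ⟨t, ht⟩ := hlow
  refine ⟨t, SupportedFrom.sum fun k hk => ?_⟩
  obtain ⟨l, hl⟩ := Int.le.dest (ht k hk)
  refine SupportedFrom.mono l ?_
  convert! (hs k).mul (hf.iterate_serDer k) using 1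
  have h := congrArg (Int.cast : ℤ → C) hl
  push_cast at h
  linear_combination h

/-- If `U` is `x - α` times an integral matrix, then `f` and `f - U f` are integral
simultaneously. -/
theorem integralFrom_iff_sub_mulVec {C K : Type*} [Field C] [CharZero C] [Field K]
    {ι : Threshold C} {n : Type*} [Fintype n]
    {U : Matrix n n (GenSeries C K)} (hU : ∀ i j, IntegralFrom ι 1 (U i j))
    {f : n → GenSeries C K} (hf : ∃ s : ℕ, ∀ i, IntegralFrom ι (-s) (f i)) :
    (∀ i, IntegralFrom ι 0 (f i)) ↔ ∀ i, IntegralFrom ι 0 (f i - U.mulVec f i) := by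
  have hmul : ∀ s : ℤ, (∀ i, IntegralFrom ι s (f i)) →
      ∀ i, IntegralFrom ι (1 + s) (U.mulVec f i) := fun s h i =>
    IntegralFrom.sum fun j _ => (hU i j).mul (h j)
  constructor
  · intro h i
    rw [sub_eq_add_neg]
    exact (h i).add ((hmul 0 h i).mono (by norm_num)).neg
  · intro h
    obtain ⟨s, hs⟩ := hf
    -- Each pass writes `f = (f - U f) + U f`; the factor `x - α` in `U` lowers the defect `s` by
    -- one.
    induction s with
    | zero => simpa using hs
    | succ s ih =>
      refine ih fun i => ?_
      rw [← sub_add_cancel (f i) (U.mulVec f i)]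
      exact ((h i).mono (by omega)).add ((hmul _ hs i).mono (by push_cast; omega))

theorem sum_fin_natCast_val {C : Type*} [Field C] [CharZero C] (r : ℕ) :
    ∑ l : Fin r, ((l : ℕ) : C) = (r : C) * ((r : C) - 1) / 2 := by
  rw [Fin.sum_univ_eq_sum_range fun l => (l : C)]
  induction r with
  | zero => simp
  | succ r ih =>
    rw [Finset.sum_range_succ, ih]
    push_cast
    ring

end Comparison
end

/-! ### The truncation theorem -/

theorem mainTheorem3 {C K : Type*} [Field C] [CharZero C] [Field K] [IsAlgClosed K] [Algebra C K]
    (ι : Threshold C) (α : K) (L : DiffOp C) {r : ℕ} (b : Fin r → GenSeries C K)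
    (hb : IsFundamentalSystem α (IntermediateField.adjoin C {α}) L b)
    (ν : Fin r → C) (hν : ∀ i, HasLeadingExponent (b i) (ν i))
    (d : Fin r → ℕ) (hd : ∀ (i : Fin r) (k : ℕ), (expCoeff (b i) (ν i + k)).natDegree ≤ d i)
    (m : ℕ)
    (hm : HasLeadingExponent (seriesWronskian b) (∑ i, ν i - (r : C) * ((r : C) - 1) / 2 + m))
    (N : Fin r → ℕ)
    (hN : ∀ i, IsGreatest
      {n : ℤ | ∃ (j : Fin r) (k : ℕ), k < d i + r ∧ (n : C) = ι.value (ν i - ν j) k - (ν i - ν j)}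
      ((N i : ℤ) - m))
    (B : DiffOp C ⧸ leftIdeal L) :
    (∀ i, IsIntegralSeries ι (actClass α B (b i))) ↔
      ∀ i, IsIntegralSeries ι (actClass α B (truncate (ν i) (N i) (b i))) := by
  have hs := fun i => (hν i).supportedFrom
  have hW : ∀ i (j : Fin r), SupportedFrom (ν i - ((j : ℕ) : C)) (wronskianMatrix b i j) := fun i j =>
    (hs i).iterate_serDer j
  obtain ⟨A, hA⟩ := exists_map_serDer_eq_mul hb.ne_zero hb.order_eq hb.solution
  have htr : serDer C K (wronskianMatrix b).det =
      Polynomial.C A.trace * (wronskianMatrix b).det := by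
    rw [(serDer C K).det_of_map_eq_mul hA]
    simp [Matrix.trace]
  obtain ⟨v, hv, hvs⟩ := HasLeadingExponent.exists_mul_eq_one hm htr
  obtain ⟨V, hV⟩ : ∃ V, V = v • (wronskianMatrix b).adjugate := ⟨_, rfl⟩
  have hWV : wronskianMatrix b * V = 1 := by
    have h : v * (wronskianMatrix b).det = 1 := (mul_comm _ _).trans hv
    rw [hV, Matrix.mul_smul, Matrix.mul_adjugate, smul_smul, h, one_smul]
  -- Rows of `W` have weights `ν i`, columns the weights `0, …, r - 1`. The total weight in the
  -- adjugate cancels against the exponent of the inverse determinant, leaving only `-m`.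
  have hVs : ∀ (k : Fin r) j, SupportedFrom (((k : ℕ) : C) - ν j - m) (V k j) := fun k j => by
    rw [hV]
    convert! hvs.mul (SupportedFrom.adjugate (σ := fun l : Fin r => ((l : ℕ) : C)) hW k j) using 1
    rw [sum_fin_natCast_val]
    ring
  have hVdeg : ∀ k j μ l, HasTerm (V k j) μ l → l < r := fun k j μ l h =>
    h.lt_of_iterate_derivative_eq_zero (iterate_derivative_inverse_eq_zero hA hWV k j)
  obtain ⟨E, hE⟩ : ∃ E, E = wronskianMatrix fun i => b i - truncate (ν i) (N i) (b i) := ⟨_, rfl⟩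
  have hEs : ∀ i (k : Fin r), SupportedFrom (ν i + N i + 1 - ((k : ℕ) : C)) (E i k) := fun i k => by
    rw [hE]
    exact ((hs i).sub_truncate (N i)).iterate_serDer k
  have hEdeg : ∀ i k, (E i k).natDegree ≤ d i := fun i k => by
    rw [hE]
    exact (natDegree_iterate_serDer_le _ _).trans
      ((natDegree_sub_truncate_le _ _ _).trans ((hs i).natDegree_le (hd i)))
  -- Exponents of the entry lie in `ν i - ν j + N i + 1 - m + ℕ`. Logarithmic degrees are at most `d
  -- i` in `E` and at most `r - 1` in `V`, so only `l < d i + r` occurs. For these, `N i - m` bounds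
  -- `ι - (ν i - ν j)`, which leaves a margin of one.
  have hU : ∀ i j, IntegralFrom ι 1 ((E * V) i j) := by
    intro i j
    rw [Matrix.mul_apply]
    refine IntegralFrom.sum fun k _ μ l h => ?_
    obtain ⟨n, hn⟩ := (hEs i k).mul (hVs k j) μ l h
    obtain ⟨μ₁, μ₂, l₁, l₂, -, hl, h1, h2⟩ := h.of_mul
    have hlt : l < d i + r := by
      have := h1.le_natDegree.trans (hEdeg i k)
      have := hVdeg k j _ _ h2
      omega
    have hμ : μ = ν i - ν j + ((N i + 1 - m + n : ℤ) : C) := by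
      rw [hn]
      push_cast
      ring
    rw [hμ, ι.value_add_intCast]
    obtain ⟨z, hz⟩ := ι.mem_coset (ν i - ν j) l
    have hz' : ι.value (ν i - ν j) l = ν i - ν j + z := hz
    have hle := (hN i).2 ⟨j, l, hlt, show (z : C) = _ by rw [hz']; ring⟩
    obtain ⟨p, hp⟩ := Int.le.dest hle
    refine ⟨p + n, ?_⟩
    have hp' := congrArg (Int.cast : ℤ → C) hp
    push_cast at hp' ⊢
    rw [hz']
    linear_combination -hp'
  have hred : ∀ i, r ≤ i → (reduced B).coeff i = 0 := fun i hi =>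
    (reduced_spec hb.ne_zero B).2 i (hb.order_eq.trans_le hi)
  set c : Fin r → GenSeries C K := fun k => Polynomial.C (expandRat α ((reduced B).coeff k))
  have hact : ∀ (f : Fin r → GenSeries C K) i,
      actClass α B (f i) = (wronskianMatrix f).mulVec c i := fun f i =>
    act_eq_mulVec α hred f i
  -- Inserting `V W = 1` expresses the error `E c` through `W c`, that is, through the series `B ·
  -- b_i` themselves.
  have hEb : E.mulVec c = (E * V).mulVec ((wronskianMatrix b).mulVec c) := by
    rw [Matrix.mulVec_mulVec, mul_assoc, mul_eq_one_comm.mp hWV, mul_one]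
  have hT : ∀ i, actClass α B (truncate (ν i) (N i) (b i)) =
      actClass α B (b i) - (E * V).mulVec (fun i => actClass α B (b i)) i := by
    intro i
    have h1 : (fun i => actClass α B (b i)) = (wronskianMatrix b).mulVec c := funext (hact b)
    have h2 : wronskianMatrix (fun i => truncate (ν i) (N i) (b i)) = wronskianMatrix b - E := by
      ext1 i k
      rw [Matrix.sub_apply, hE, wronskianMatrix_apply, wronskianMatrix_apply,
        wronskianMatrix_apply, ← iterate_map_sub, sub_sub_cancel]
    rw [h1, ← hEb, hact b, hact fun i => truncate (ν i) (N i) (b i), h2, Matrix.sub_mulVec]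
    rfl
  have hbound : ∃ s : ℕ, ∀ i, IntegralFrom ι (-s) (actClass α B (b i)) := by
    have h1 : ∀ i, ∃ s : ℕ, IntegralFrom ι (-s) (actClass α B (b i)) := fun i => by
      obtain ⟨s, h⟩ := (hs i).exists_act α (reduced B)
      exact h.exists_integralFrom ι
    choose s h using h1
    refine ⟨∑ i, s i, fun i => (h i).mono ?_⟩
    have := Finset.single_le_sum (f := s) (fun _ _ => Nat.zero_le _) (Finset.mem_univ i)
    omega
  simp only [isIntegralSeries_iff, hT]
  exact integralFrom_iff_sub_mulVec hU hbound
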